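/- **Setting.** Let $d\ge 1$, let $\Omega\subset\mathbb R^d$ be open, $k,p\in\mathbb N_0$, and let $\{\mathscr T_h\}_h$ be a family of finite meshes on $\Omega$, possibly with hanging nodes. The elements $K$ of each mesh are pairwise disjoint and satisfy $\bigcup_{K\in\mathscr T_h}\overline K=\overline\Omega$. Each element is $K=F_K(\hat K)$, where $\hat K$ is the open unit simplex (or the open unit cube), $F_K(\hat x)=B_K\hat x+b_K+\Phi_K(\hat x)$ with $B_K$ an invertible matrix, $\Phi_K\in C^1(\overline{\hat K};\mathbb R^d)$ and $C_K:=\sup_{\hat K}\|D\Phi_K B_K^{-1}\|<1$. Put $\tilde K=B_K\hat K$ and $h_K=\operatorname{diam}\tilde K$. Assume that * the family is shape-regular: there are $\sigma>0$ and $c<1$ such that, for all $h$ and all $K\in\mathscr T_h$, $\tilde K$ contains a ball of radius $\sigma h_K$, and $C_K\le c$; * $F_K\in C^k(\overline{\hat K};\mathbb R^d)$ for all $h$ and $K\in\mathscr T_h$, and $\sup_h\sup_{K\in\mathscr T_h}\sup_{\hat x\in\hat K}\|\nabla^lF_K(\hat x)\|\,\|B_K\|^{-l}<\infty$ for $2\le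 l\le k$. Let $V_{h,p}$ be the space of $v\in L^2(\Omega)$ such that, for every $K\in\mathscr T_h$, $v|_K=\rho\circ F_K^{-1}$ for some polynomial $\rho$ of (total or partial) degree at most $p$. An interior face of $\mathscr T_h$ is the relative interior (if nonempty) of the intersection of a curved facet $F_K(\hat E)$ of $K$ and a curved facet of another element $K'$; a boundary face is the relative interior (if nonempty) of $F_K(\hat E)\cap\partial\Omega$ in a curved facet $F_K(\hat E)$ of $K$. Here $\hat E$ denotes a relatively open $(d-1)$-dimensional face of $\hat K$. Let $\tilde h_F$ be the minimum of $h_K$ over the elements $K$ of which $F$ is a face. For a function $g\in C^m(\overline F)$ put $\|g\|_{H^m(F)}^2=\sum_{r=0}^m\int_F|\nabla_{\mathbf T}^r g|^2\,dS$, where $\nabla_{\mathbf T}$ is the tangential gradient on $F$ and $\nabla_{\mathbf T}^r g$ the array of its $r$-fold iterated Cartesian components. **Lemma (trace inverse estimate).** Let $\delta>0$. There is a constant $C>0$, independent of $h$, $K$, $F$, $v$ and $m$, such that for every $h$, every $K\in\mathscr T_h$, every interior or boundary face $F$ of $K$, and every $v\in V_{h,p}$: 1. the trace $\tau_F(v|_K)$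 belongs to $C^k(\overline F)$, and its norm in $H^m(F)$ is finite for every integer $0\le m\le k$; 2. if $F\supseteq F_K(\hat E\cap B(\hat x,\delta))$ for some $(d-1)$-dimensional relatively open face $\hat E$ of $\hat K$ and some $\hat x\in\hat E$ (this is always the case if $F$ is an entire curved facet of $K$), then $$\|\tau_F(v|_K)\|_{H^m(F)}\le C\,\tilde h_F^{-m}\,\|\tau_F(v|_K)\|_{L^2(F)}\qquad\text{for every integer }0\le m\le k.$$ -/

import Mathlib

open MeasureTheory Filter Topology Set
open scoped ENNReal

noncomputable section

namespace CurvedDG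

/-- Euclidean space `ℝᵈ`. -/
abbrev E (d : ℕ) : Type := EuclideanSpace ℝ (Fin d)

/-! ### Reference elements and polynomial spaces -/

/-- The two kinds of reference elements: the unit simplex and the unit cube (whose images under
invertible affine maps are the parallelepipeds). -/
inductive RefShape
  | simplex
  | cube

/-- The open reference element `K̂`. -/
def RefShape.interior (d : ℕ) : RefShape → Set (E d)
  | .simplex => {x | (∀ i, 0 < x i) ∧ ∑ i, x i < 1}
  | .cube => {x | ∀ i, 0 < x i ∧ x i < 1}

/-- The closed reference element. -/
def RefShape.closed (d : ℕ) (s : RefShape) : Set (E d) := closure (s.interior d)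

/-- The relatively open `(d-1)`-dimensional faces of the reference element. -/
def RefShape.facets (d : ℕ) : RefShape → Set (Set (E d))
  | .simplex =>
      {A | (∃ i, A = {x | x i = 0 ∧ (∀ j, j ≠ i → 0 < x j) ∧ ∑ j, x j < 1}) ∨
        A = {x | (∀ j, 0 < x j) ∧ ∑ j, x j = 1}}
  | .cube =>
      {A | ∃ i, ∃ a : ℝ, (a = 0 ∨ a = 1) ∧
        A = {x | x i = a ∧ ∀ j, j ≠ i → 0 < x j ∧ x j < 1}}

/-- Whether the polynomial degree is the total degree or the partial degree
(the maximal degree in each single variable). -/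
inductive DegreeKind
  | total
  | perVariable

/-- The set `ℙᵖ` of real polynomials in `d` variables of total, respectively partial, degree at
most `p`. -/
def polySpace (d p : ℕ) : DegreeKind → Set (MvPolynomial (Fin d) ℝ)
  | .total => {ρ | ρ.totalDegree ≤ p}
  | .perVariable => {ρ | ∀ i, ρ.degreeOf i ≤ p}

/-! ### Curved elements -/

/-- A curved element: the image of a reference element under `F_K = F̃_K + Φ_K`, with
`F̃_K x̂ = B x̂ + b` affine and invertible, `Φ_K` of class `C¹` up to the boundary of the reference
element, and `C_K = sup ‖DΦ_K B⁻¹‖ < 1`. -/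
structure CurvedElement (d : ℕ) where
  /-- the kind of the reference element -/
  shape : RefShape
  /-- the linear part of the affine map -/
  B : E d ≃L[ℝ] E d
  /-- the translation part of the affine map -/
  b : E d
  /-- the perturbation -/
  Φ : E d → E d
  contDiffOn_Φ : ContDiffOn ℝ 1 Φ (shape.closed d)
  distortion_lt_one :
    ⨆ x ∈ shape.closed d,
      ENNReal.ofReal ‖(fderivWithin ℝ Φ (shape.closed d) x).comp (B.symm : E d →L[ℝ] E d)‖ < 1

namespace CurvedElement

variable {d : ℕ} (K : CurvedElement d)

/-- The closed reference element of `K`. -/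
def refClosed : Set (E d) := K.shape.closed d

/-- The map `F_K`. -/
def map (x : E d) : E d := K.B x + K.b + K.Φ x

/-- The (open) element `K = F_K(K̂)`. -/
def carrier : Set (E d) := K.map '' K.shape.interior d

/-- The inverse `F_K⁻¹ : K → K̂`. -/
def invMap : E d → E d := Function.invFunOn K.map (K.shape.interior d)

/-- `C_K`, the supremum of `‖DΦ_K B⁻¹‖` over the reference element. -/
def distortion : ℝ≥0∞ :=
  ⨆ x ∈ K.shape.closed d,
    ENNReal.ofReal
      ‖(fderivWithin ℝ K.Φ (K.shape.closed d) x).comp (K.B.symm : E d →L[ℝ] E d)‖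

/-- The straight element `K̃ = B(K̂)`. -/
def straight : Set (E d) := K.B '' K.shape.interior d

/-- The element size `h_K = diam K̃`. -/
def size : ℝ := Metric.diam K.straight

end CurvedElement

/-! ### Meshes and their faces -/

/-- A finite mesh of curved elements which is exact for `Ω`: the (open) elements are pairwise
disjoint and their closures cover exactly the closure of `Ω`. Hanging nodes are allowed. -/
structure Mesh (d : ℕ) (Ω : Set (E d)) where
  /-- labels of the elements -/
  Elem : Type
  finite : Finite Elem
  /-- the elements -/
  elem : Elem → CurvedElement d
  disjoint : Pairwise fun K K' => Disjoint (elem K).carrier (elem K').carrier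
  cover : ⋃ K, closure (elem K).carrier = closure Ω

namespace Mesh

variable {d : ℕ} {Ω : Set (E d)} (T : Mesh d Ω)

/-- `F` is an interior face, shared by the distinct elements `K` and `K'`: it is the nonempty set
of points at which a curved (relatively open) facet of `K` and one of `K'` coincide locally, that
is, the relative interior of the intersection of the two facets. -/
def IsInteriorFace (K K' : T.Elem) (F : Set (E d)) : Prop :=
  K ≠ K' ∧ F.Nonempty ∧
    ∃ A ∈ (T.elem K).shape.facets d, ∃ A' ∈ (T.elem K').shape.facets d,
      F = {x | x ∈ (T.elem K).map '' A ∧ x ∈ (T.elem K').map '' A' ∧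
        𝓝[(T.elem K).map '' A] x = 𝓝[(T.elem K').map '' A'] x}

/-- `F` is a boundary face, belonging to `K`: it is the nonempty relative interior of the part
of a curved (relatively open) facet of `K` that lies on the boundary of `Ω`. -/
def IsBoundaryFace (K : T.Elem) (F : Set (E d)) : Prop :=
  F.Nonempty ∧
    ∃ A ∈ (T.elem K).shape.facets d,
      F = {x | x ∈ (T.elem K).map '' A ∧ frontier Ω ∈ 𝓝[(T.elem K).map '' A] x}

/-- `F` is an interior or boundary face of the mesh and a face of the element `K`. -/
def IsFaceOf (K : T.Elem) (F : Set (E d)) : Prop :=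
  (∃ K', T.IsInteriorFace K K' F ∨ T.IsInteriorFace K' K F) ∨ T.IsBoundaryFace K F

/-- `h̃_F`: the smallest size of the elements having `F` as a face; this is `min (h_K, h_K')`
for an interior face between `K` and `K'`, and `h_K` for a boundary face of `K`. -/
def faceSize (F : Set (E d)) : ℝ :=
  sInf ((fun K => (T.elem K).size) '' {K | T.IsFaceOf K F})

/-- The face `F` occupies a portion of size at least `δ` (measured on the reference element) of a
facet of `K`. If `F` is an entire curved facet of `K`, this holds for every `δ`; for a mesh with
hanging nodes it excludes that `F` is an arbitrarily small part of a facet of `K`. -/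
def IsCommensurate (δ : ℝ) (K : T.Elem) (F : Set (E d)) : Prop :=
  ∃ A ∈ (T.elem K).shape.facets d, ∃ x ∈ A,
    (T.elem K).map '' (A ∩ Metric.ball x δ) ⊆ F

/-- The discontinuous Galerkin space `V_{h,p}`: (representatives of) the functions in `L²(Ω)` which
on every element `K` are of the form `ρ ∘ F_K⁻¹`, with `ρ` a polynomial of degree at most `p`. The
degree may be understood differently on simplices and on parallelepipeds. -/
def dgSpace (κ : RefShape → DegreeKind) (p : ℕ) : Set (E d → ℝ) :=
  {v | MemLp v 2 (volume.restrict Ω) ∧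
    ∀ K, ∃ ρ ∈ polySpace d p (κ (T.elem K).shape),
      v =ᵐ[volume.restrict (T.elem K).carrier]
        fun x => MvPolynomial.eval (fun i => (T.elem K).invMap x i) ρ}

end Mesh

/-- A family of meshes is shape-regular: the straight elements `K̃` contain balls of radius
comparable to their diameter, and the distortions `C_K` are bounded away from `1`, uniformly. -/
def IsShapeRegular {d : ℕ} {Ω : Set (E d)} {I : Type*} (T : I → Mesh d Ω) : Prop :=
  (∃ σ : ℝ, 0 < σ ∧ ∀ i, ∀ K : (T i).Elem, ∃ x,
      Metric.ball x (σ * ((T i).elem K).size) ⊆ ((T i).elem K).straight) ∧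
    ∃ c : ℝ≥0∞, c < 1 ∧ ∀ i, ∀ K : (T i).Elem, ((T i).elem K).distortion ≤ c

/-- The element maps `F_K` of a family of meshes are of class `Cᵏ` up to the boundary, with
`sup_h sup_K sup_x̂ ‖∇ˡ F_K(x̂)‖ ‖B_K‖⁻ˡ < ∞` for `2 ≤ l ≤ k`. -/
def HasRegularMaps {d : ℕ} {Ω : Set (E d)} {I : Type*} (k : ℕ) (T : I → Mesh d Ω) : Prop :=
  (∀ i, ∀ K : (T i).Elem,
      ContDiffOn ℝ k ((T i).elem K).map ((T i).elem K).refClosed) ∧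
    ∀ l : ℕ, 2 ≤ l → l ≤ k → ∃ M : ℝ, ∀ i, ∀ K : (T i).Elem, ∀ x ∈ ((T i).elem K).refClosed,
      ‖iteratedFDerivWithin ℝ l ((T i).elem K).map ((T i).elem K).refClosed x‖ ≤
        M * ‖(((T i).elem K).B : E d →L[ℝ] E d)‖ ^ l

/-! ### Traces and Sobolev norms on hypersurfaces -/

/-- The surface measure on `F ⊆ ℝᵈ`, i.e. the `(d-1)`-dimensional Hausdorff measure. -/
def surfaceMeasure {d : ℕ} (F : Set (E d)) : Measure (E d) :=
  (Measure.euclideanHausdorffMeasure (d - 1) : Measure (E d)).restrict F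

/-- `g` is (a representative of) the trace on `F ⊆ ∂K` of the restriction of `v` to `K`: at almost
every point `x` of `F`, the averages of `|v - g x|` over `K ∩ B(x,r)` tend to `0` as `r → 0`. -/
def IsTrace {d : ℕ} (K F : Set (E d)) (v g : E d → ℝ) : Prop :=
  ∀ᵐ x ∂(surfaceMeasure F),
    Tendsto (fun r : ℝ => ⨍ y in K ∩ Metric.ball x r, |v y - g x|) (𝓝[>] 0) (𝓝 0)

/-- The tangent space of `F ⊆ ℝᵈ` at `x`. -/
def tangentSpaceAt {d : ℕ} (F : Set (E d)) (x : E d) : Submodule ℝ (E d) :=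
  Submodule.span ℝ (tangentConeAt ℝ F x)

/-- The component `∇_T g · e` of the tangential gradient on `F`: the derivative of `g` along `F` in
the direction of the orthogonal projection of `e` to the tangent space. -/
def tangentialDeriv {d : ℕ} (F : Set (E d)) (e : E d) (g : E d → ℝ) : E d → ℝ :=
  fun x => fderivWithin ℝ g F x ((tangentSpaceAt F x).starProjection e)

/-- Iterated components of the tangential gradient. -/
def iterTangentialDeriv {d : ℕ} (F : Set (E d)) : List (Fin d) → (E d → ℝ) → E d → ℝ
  | [], g => g
  | i :: α, g => tangentialDeriv F (EuclideanSpace.single i 1) (iterTangentialDeriv F α g)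

/-- The square of the seminorm `|g|_{H^r(F)}`, with `F` a (relatively open) hypersurface. -/
def sobolevSeminormSq {d : ℕ} (F : Set (E d)) (r : ℕ) (g : E d → ℝ) : ℝ≥0∞ :=
  ∑ α : Fin r → Fin d, ∫⁻ x, ‖iterTangentialDeriv F (List.ofFn α) g x‖ₑ ^ 2 ∂(surfaceMeasure F)

/-- The norm `‖g‖_{H^m(F)}` of a function `g` of class `C^m` on the hypersurface `F`. -/
def sobolevNorm {d : ℕ} (F : Set (E d)) (m : ℕ) (g : E d → ℝ) : ℝ≥0∞ :=
  (∑ r ∈ Finset.range (m + 1), sobolevSeminormSq F r g) ^ (1 / 2 : ℝ)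

end CurvedDG

end

/-!
Up to the factor `h = h_K`, the map `f = F_K` of a shape-regular element looks the same for all
elements (`IsScaledMap`, `CurvedElement.exists_isScaledMap`): `f / h` is bi-Lipschitz, its first
derivative is bounded together with its inverse, and its derivatives of higher order are bounded.
The last point uses that the sizes `h_K` are bounded, because a domain with a finite exact mesh is
bounded.

A face `F` of `K` is a relatively open part of `f(A)`, with `A` a facet of the reference element
in a hyperplane with direction `H` (`Mesh.IsFaceOf.exists_facet`), and the inverse of `f` is of
class `Cᵏ` up to the boundary (`IsScaledMap.contDiffOn_inv`), so that the mapped polynomial `u ∘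
f⁻¹` is the trace. The tangent space of `F` at `f x` is `Df(x)(H)`. Hence the component `e` of the
tangential gradient of `u ∘ f⁻¹` at `f x` is `Du(x)` applied to the vector of `H` which `Df(x)`
sends to the tangential part of `e`, that is, to the image of `e` under the Moore-Penrose inverse
of `Df(x)|_H`. This inverse is a smooth function of `Df(x)` and homogeneous of degree `-1`; by
compactness its derivatives along the reference element are bounded after multiplication by `h`.
By induction, `r`-fold tangential derivatives of `u ∘ f⁻¹` are bounded by `h⁻ʳ` times the
derivatives of `u`, therefore by `h⁻ʳ` times the norm of the coefficients of `u`
(`IsFlatFacet.exists_abs_iterTangentialDeriv_le`).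

In the other direction, the polynomials restricted to the hyperplane of `A` form a
finite-dimensional space, and all norms on it are equivalent. If `F` contains the image of `A ∩
B(x, δ)`, this gives, uniformly in `x`, a ball of fixed radius in `A ∩ B(x, δ)` on which `|u|` is
at least a fixed multiple of the norm of the coefficients, provided that the coefficients are
first changed in a way that is invisible on `A` (`IsFlatFacet.exists_polyFun_norm_le`). The
surface measures of `F` and of the image of that ball are both of the order of `h ^ (d - 1)`,
since Lipschitz maps distort Hausdorff measure by a power of their Lipschitz constant. These
powers cancel in the comparison of the Sobolev norm with the `L²` norm
(`IsFlatFacet.exists_le_lintegral`, `IsFlatFacet.exists_sobolevNorm_le`).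
-/

noncomputable section

namespace CurvedDG

/-! ### Geometry of the reference elements -/

/-- `A ⊆ S` is a relatively open convex piece of the hyperplane `{ℓ = a}`. -/
structure IsFlatFacet {d : ℕ} (S A : Set (E d)) (ℓ : E d →L[ℝ] ℝ) (a : ℝ) : Prop where
  ne_zero : ℓ ≠ 0
  convex : Convex ℝ A
  subset : A ⊆ S
  exists_isOpen : ∃ U : Set (E d), IsOpen U ∧ A = {x | ℓ x = a} ∩ U

namespace RefShape

variable {d : ℕ}

theorem isOpen_interior (s : RefShape) : IsOpen (s.interior d) := by
  cases s
  · simp only [RefShape.interior, ofPred_and, ofPred_forall]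
    exact (isOpen_iInter_of_finite fun i => isOpen_lt (by fun_prop) (by fun_prop)).inter
      (isOpen_lt (by fun_prop) (by fun_prop))
  · simp only [RefShape.interior, ofPred_and, ofPred_forall]
    exact isOpen_iInter_of_finite fun i =>
      (isOpen_lt (by fun_prop) (by fun_prop)).inter (isOpen_lt (by fun_prop) (by fun_prop))

theorem convex_interior (s : RefShape) : Convex ℝ (s.interior d) := by
  rintro x hx y hy α β hα hβ hαβ
  cases s
  · refine ⟨fun i => ?_, ?_⟩
    · have h1 := hx.1 i
      have h2 := hy.1 i
      simp only [PiLp.add_apply, PiLp.smul_apply, smul_eq_mul]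
      rcases hα.eq_or_lt with h | h
      · rw [← h] at hαβ ⊢
        nlinarith
      · nlinarith [mul_pos h h1, mul_nonneg hβ h2.le]
    · have h1 := hx.2
      have h2 := hy.2
      simp only [PiLp.add_apply, PiLp.smul_apply, smul_eq_mul, Finset.sum_add_distrib,
        ← Finset.mul_sum]
      rcases hα.eq_or_lt with h | h
      · rw [← h] at hαβ ⊢
        nlinarith
      · nlinarith [mul_lt_mul_of_pos_left h1 h, mul_le_mul_of_nonneg_left h2.le hβ]
  · intro i
    have h1 := hx i
    have h2 := hy i
    simp only [PiLp.add_apply, PiLp.smul_apply, smul_eq_mul]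
    exact convex_Ioo (0 : ℝ) 1 h1 h2 hα hβ hαβ

/-- A point of the open reference element: its barycentre. -/
def center (s : RefShape) (d : ℕ) : E d :=
  WithLp.toLp 2 fun _ => match s with
    | .simplex => 1 / (d + 1 : ℝ)
    | .cube => 1 / 2

theorem center_mem (s : RefShape) : s.center d ∈ s.interior d := by
  cases s
  · refine ⟨fun i => by simp only [center]; positivity, ?_⟩
    simp only [center, Finset.sum_const, Finset.card_univ, Fintype.card_fin, nsmul_eq_mul]
    rw [mul_one_div, div_lt_one (by positivity)]
    linarith
  · intro i
    simp only [center]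
    norm_num

theorem interior_subset_Icc (s : RefShape) {x : E d} (hx : x ∈ s.interior d) (i : Fin d) :
    0 ≤ x i ∧ x i ≤ 1 := by
  cases s
  · refine ⟨(hx.1 i).le, ?_⟩
    have := Finset.single_le_sum (f := fun i => x i) (fun j _ => (hx.1 j).le) (Finset.mem_univ i)
    exact this.trans hx.2.le
  · exact ⟨(hx i).1.le, (hx i).2.le⟩

theorem isBounded_interior (s : RefShape) : Bornology.IsBounded (s.interior d) := by
  refine (Metric.isBounded_closedBall (x := (0 : E d)) (r := √(d : ℝ))).subset fun x hx => ?_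
  rw [mem_closedBall_zero_iff, EuclideanSpace.norm_eq]
  refine Real.sqrt_le_sqrt ?_
  calc ∑ i, ‖x i‖ ^ 2 ≤ ∑ _i : Fin d, (1 : ℝ) := by
        refine Finset.sum_le_sum fun i _ => ?_
        have := s.interior_subset_Icc hx i
        rw [Real.norm_eq_abs, sq_abs]
        nlinarith
    _ = d := by simp

theorem isCompact_closed (s : RefShape) : IsCompact (s.closed d) :=
  s.isBounded_interior.isCompact_closure

theorem convex_closed (s : RefShape) : Convex ℝ (s.closed d) := s.convex_interior.closure

theorem interior_subset_closed (s : RefShape) : s.interior d ⊆ s.closed d := subset_closure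

theorem interior_closed_nonempty (s : RefShape) : (_root_.interior (s.closed d)).Nonempty :=
  ⟨s.center d, interior_mono s.interior_subset_closed
    (by rw [s.isOpen_interior.interior_eq]; exact s.center_mem)⟩

theorem uniqueDiffOn_closed (s : RefShape) : UniqueDiffOn ℝ (s.closed d) :=
  uniqueDiffOn_convex s.convex_closed s.interior_closed_nonempty

/-- A point from which the segment to the barycentre runs through the open reference element
lies in the closed reference element. -/
theorem mem_closed_of_forall (s : RefShape) {x : E d}
    (hx : ∀ t : ℝ, 0 < t → t ≤ 1 → x + t • (s.center d - x) ∈ s.interior d) : x ∈ s.closed d := by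
  have hc : Tendsto (fun t : ℝ => x + t • (s.center d - x)) (𝓝[>] 0) (𝓝 x) := by
    have : Continuous fun t : ℝ => x + t • (s.center d - x) := by fun_prop
    have h := this.tendsto 0
    simp only [zero_smul, add_zero] at h
    exact h.mono_left nhdsWithin_le_nhds
  refine mem_closure_of_tendsto hc ?_
  filter_upwards [Ioc_mem_nhdsGT (zero_lt_one' ℝ)] with t ht using hx t ht.1 ht.2

theorem simplex_mem_closed {x : E d} (h0 : ∀ i, 0 ≤ x i) (h1 : ∑ i, x i ≤ 1) :
    x ∈ simplex.closed d := by
  refine simplex.mem_closed_of_forall fun t ht ht1 => ?_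
  have hc := simplex.center_mem (d := d)
  refine ⟨fun i => ?_, ?_⟩
  · simp only [PiLp.add_apply, PiLp.smul_apply, PiLp.sub_apply, smul_eq_mul]
    nlinarith [mul_pos ht (hc.1 i), mul_nonneg (sub_nonneg.2 ht1) (h0 i)]
  · simp only [PiLp.add_apply, PiLp.smul_apply, PiLp.sub_apply, smul_eq_mul,
      Finset.sum_add_distrib, ← Finset.mul_sum, Finset.sum_sub_distrib]
    nlinarith [mul_lt_mul_of_pos_left hc.2 ht, mul_le_mul_of_nonneg_left h1 (sub_nonneg.2 ht1)]

theorem cube_mem_closed {x : E d} (h : ∀ i, 0 ≤ x i ∧ x i ≤ 1) : x ∈ cube.closed d := by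
  refine cube.mem_closed_of_forall fun t ht ht1 i => ?_
  have hc := cube.center_mem (d := d) i
  simp only [PiLp.add_apply, PiLp.smul_apply, PiLp.sub_apply, smul_eq_mul]
  have h1 := h i
  constructor
  · nlinarith [mul_pos ht hc.1, mul_nonneg (sub_nonneg.2 ht1) h1.1]
  · nlinarith [mul_lt_mul_of_pos_left hc.2 ht, mul_le_mul_of_nonneg_left h1.2 (sub_nonneg.2 ht1)]

theorem exists_isFlatFacet (hd : 1 ≤ d) (s : RefShape) {A : Set (E d)} (hA : A ∈ s.facets d) :
    ∃ ℓ a, IsFlatFacet (s.closed d) A ℓ a := by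
  -- a hyperplane piece cut out by open convex conditions
  have key : ∀ (ℓ : E d →L[ℝ] ℝ) (a : ℝ) (U : Set (E d)), ℓ ≠ 0 → IsOpen U → Convex ℝ U →
      {x | ℓ x = a} ∩ U ⊆ s.closed d → A = {x | ℓ x = a} ∩ U →
      ∃ ℓ a, IsFlatFacet (s.closed d) A ℓ a := by
    intro ℓ a U h0 hU hUc hs hAU
    exact ⟨ℓ, a, h0, hAU ▸ ((convex_singleton a).linear_preimage ℓ.toLinearMap).inter hUc,
      hAU ▸ hs, U, hU, hAU⟩
  have hp : ∀ (i : Fin d) (x : E d), (EuclideanSpace.proj i : E d →L[ℝ] ℝ) x = x i :=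
    fun _ _ => rfl
  have hproj : ∀ i : Fin d, (EuclideanSpace.proj i : E d →L[ℝ] ℝ) ≠ 0 := fun i h => by
    have := DFunLike.congr_fun h (EuclideanSpace.single i (1 : ℝ))
    simp at this
  have hpos : ∀ j : Fin d, IsOpen {x : E d | 0 < x j} ∧ Convex ℝ {x : E d | 0 < x j} := fun j =>
    ⟨isOpen_lt (by fun_prop) (by fun_prop),
      (convex_Ioi (0 : ℝ)).linear_preimage (EuclideanSpace.proj j : E d →L[ℝ] ℝ).toLinearMap⟩
  have hlt : ∀ j : Fin d, IsOpen {x : E d | x j < 1} ∧ Convex ℝ {x : E d | x j < 1} := fun j =>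
    ⟨isOpen_lt (by fun_prop) (by fun_prop),
      (convex_Iio (1 : ℝ)).linear_preimage (EuclideanSpace.proj j : E d →L[ℝ] ℝ).toLinearMap⟩
  let tot : E d →L[ℝ] ℝ := ∑ j, EuclideanSpace.proj j
  have htot : ∀ x : E d, tot x = ∑ j, x j := fun x => by
    simp [tot]
  have hsum : IsOpen {x : E d | ∑ j, x j < 1} ∧ Convex ℝ {x : E d | ∑ j, x j < 1} :=
    ⟨isOpen_lt (by fun_prop) (by fun_prop), by
      have h : {x : E d | ∑ j, x j < 1} = tot ⁻¹' Iio 1 := by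
        ext x
        rw [mem_preimage, htot]
        rfl
      exact h ▸ (convex_Iio (1 : ℝ)).linear_preimage tot.toLinearMap⟩
  cases s
  · rcases hA with ⟨i, rfl⟩ | rfl
    · refine key (EuclideanSpace.proj i) 0
        ((⋂ j, ⋂ (_ : j ≠ i), {x : E d | 0 < x j}) ∩ {x | ∑ j, x j < 1}) (hproj i)
        ((isOpen_iInter_of_finite fun j => isOpen_iInter_of_finite fun _ => (hpos j).1).inter
          hsum.1)
        ((convex_iInter fun j => convex_iInter fun _ => (hpos j).2).inter hsum.2) ?_ ?_
      · rintro x ⟨hx0, hx1, hx2⟩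
        simp only [mem_iInter, mem_ofPred_eq, hp] at hx0 hx1 hx2
        refine simplex_mem_closed (fun j => ?_) hx2.le
        by_cases hj : j = i
        · rw [hj, hx0]
        · exact (hx1 j hj).le
      · ext x
        simp [hp]
    · refine key tot 1 (⋂ j, {x : E d | 0 < x j}) ?_
        (isOpen_iInter_of_finite fun j => (hpos j).1) (convex_iInter fun j => (hpos j).2) ?_ ?_
      · intro h
        have := DFunLike.congr_fun h (EuclideanSpace.single (⟨0, hd⟩ : Fin d) (1 : ℝ))
        simp [htot] at this
      · rintro x ⟨hx0, hx1⟩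
        simp only [mem_iInter, mem_ofPred_eq, htot] at hx0 hx1
        exact simplex_mem_closed (fun j => (hx1 j).le) hx0.le
      · ext x
        simp [htot, and_comm]
  · rcases hA with ⟨i, a, ha, rfl⟩
    refine key (EuclideanSpace.proj i) a
      (⋂ j, ⋂ (_ : j ≠ i), ({x : E d | 0 < x j} ∩ {x : E d | x j < 1})) (hproj i)
      (isOpen_iInter_of_finite fun j => isOpen_iInter_of_finite fun _ => (hpos j).1.inter (hlt j).1)
      (convex_iInter fun j => convex_iInter fun _ => (hpos j).2.inter (hlt j).2) ?_ ?_
    · rintro x ⟨hx0, hx1⟩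
      simp only [mem_iInter, mem_ofPred_eq, mem_inter_iff, hp] at hx0 hx1
      refine cube_mem_closed fun j => ?_
      by_cases hj : j = i
      · rw [hj, hx0]
        rcases ha with rfl | rfl <;> norm_num
      · exact ⟨(hx1 j hj).1.le, (hx1 j hj).2.le⟩
    · ext x
      simp [hp]

/-- Distinct relatively open facets of the reference element are disjoint. -/
theorem facets_eq_of_mem (s : RefShape) {A A' : Set (E d)} (hA : A ∈ s.facets d)
    (hA' : A' ∈ s.facets d) {x : E d} (hx : x ∈ A) (hx' : x ∈ A') : A = A' := by
  cases s
  · rcases hA with ⟨i, rfl⟩ | rfl <;> rcases hA' with ⟨j, rfl⟩ | rfl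
    · by_cases hij : i = j
      · rw [hij]
      · exact absurd hx'.1 ((hx.2.1 j (Ne.symm hij)).ne')
    · exact absurd hx.1 (hx'.1 i).ne'
    · exact absurd hx'.1 (hx.1 j).ne'
    · rfl
  · rcases hA with ⟨i, a, ha, rfl⟩
    rcases hA' with ⟨j, b, hb, rfl⟩
    by_cases hij : i = j
    · subst hij
      rw [← hx.1, ← hx'.1]
    · have h1 := hx.2 j (Ne.symm hij)
      rw [hx'.1] at h1
      rcases hb with rfl | rfl
      · exact absurd h1.1 (lt_irrefl _)
      · exact absurd h1.2 (lt_irrefl _)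

theorem finite_facets (s : RefShape) : (s.facets d).Finite := by
  cases s
  · have : simplex.facets d ⊆
        range (fun i : Fin d => {x : E d | x i = 0 ∧ (∀ j, j ≠ i → 0 < x j) ∧ ∑ j, x j < 1}) ∪
          {{x | (∀ j, 0 < x j) ∧ ∑ j, x j = 1}} := by
      rintro A (⟨i, rfl⟩ | rfl)
      · exact Or.inl ⟨i, rfl⟩
      · exact Or.inr rfl
    exact ((finite_range _).union (finite_singleton _)).subset this
  · have : cube.facets d ⊆ (fun q : Fin d × ℝ =>
        {x : E d | x q.1 = q.2 ∧ ∀ j, j ≠ q.1 → 0 < x j ∧ x j < 1}) '' (univ ×ˢ {0, 1}) := by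
      rintro A ⟨i, a, ha, rfl⟩
      exact ⟨(i, a), ⟨mem_univ _, by simpa using ha⟩, rfl⟩
    exact ((finite_univ.prod (by simp)).image _).subset this

end RefShape

namespace IsFlatFacet

variable {d : ℕ} {S A : Set (E d)} {ℓ : E d →L[ℝ] ℝ} {a : ℝ}

theorem apply_eq (hA : IsFlatFacet S A ℓ a) {x : E d} (hx : x ∈ A) : ℓ x = a := by
  obtain ⟨U, -, rfl⟩ := hA.exists_isOpen
  exact hx.1

/-- Around each of its points, a flat facet fills a ball of its hyperplane. -/
theorem exists_ball (hA : IsFlatFacet S A ℓ a) {x : E d} (hx : x ∈ A) :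
    ∃ r > 0, ∀ y, ℓ (y - x) = 0 → ‖y - x‖ < r → y ∈ A := by
  have hax := hA.apply_eq hx
  obtain ⟨U, hU, rfl⟩ := hA.exists_isOpen
  obtain ⟨r, hr, hrU⟩ := Metric.isOpen_iff.1 hU x hx.2
  refine ⟨r, hr, fun y hy hyr => ⟨?_, hrU (by rwa [mem_ball_iff_norm])⟩⟩
  rw [map_sub, sub_eq_zero] at hy
  exact hy.trans hax

theorem measurableSet (hA : IsFlatFacet S A ℓ a) : MeasurableSet A := by
  obtain ⟨U, hU, rfl⟩ := hA.exists_isOpen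
  exact ((isClosed_singleton (x := a)).preimage ℓ.continuous).measurableSet.inter hU.measurableSet

end IsFlatFacet

/-! ### Maps that dilate by a fixed factor up to a constant, and their inverses -/

/-- `f : S → ℝᵈ` is of class `Cᵏ` and behaves like a dilation by the factor `h`, up to the constant
`Λ`: distances and derivatives of `f / h` are controlled from above and below in terms of `Λ`. -/
structure IsScaledMap {d : ℕ} (S : Set (E d)) (k : ℕ) (Λ h : ℝ) (f : E d → E d) : Prop where
  pos : 0 < Λ
  scale_pos : 0 < h
  contDiffOn_one : ContDiffOn ℝ 1 f S
  contDiffOn : ContDiffOn ℝ k f S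
  norm_sub_le : ∀ x ∈ S, ∀ y ∈ S, ‖f x - f y‖ ≤ Λ * h * ‖x - y‖
  le_norm_sub : ∀ x ∈ S, ∀ y ∈ S, h * ‖x - y‖ ≤ Λ * ‖f x - f y‖
  norm_fderivWithin_le : ∀ x ∈ S, ‖fderivWithin ℝ f S x‖ ≤ Λ * h
  le_norm_fderivWithin : ∀ x ∈ S, ∀ v, h * ‖v‖ ≤ Λ * ‖fderivWithin ℝ f S x v‖
  norm_iteratedFDerivWithin_le : ∀ l, 2 ≤ l → l ≤ k → ∀ x ∈ S,
    ‖iteratedFDerivWithin ℝ l f S x‖ ≤ Λ * h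

theorem isInvertible_of_injective {d : ℕ} {D : E d →L[ℝ] E d} (hD : Function.Injective D) :
    D.IsInvertible :=
  ⟨(LinearEquiv.ofInjectiveEndo D.toLinearMap hD).toContinuousLinearEquiv, by ext; rfl⟩

namespace IsScaledMap

variable {d k : ℕ} {S : Set (E d)} {Λ h : ℝ} {f : E d → E d}

theorem injOn (hf : IsScaledMap S k Λ h f) : InjOn f S := by
  intro x hx y hy hxy
  have h1 := hf.le_norm_sub x hx y hy
  rw [hxy, sub_self, norm_zero, mul_zero] at h1
  exact sub_eq_zero.1 (norm_le_zero_iff.1 (nonpos_of_mul_nonpos_right h1 hf.scale_pos))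

theorem continuousOn (hf : IsScaledMap S k Λ h f) : ContinuousOn f S :=
  hf.contDiffOn_one.continuousOn

theorem hasFDerivWithinAt (hf : IsScaledMap S k Λ h f) {x : E d} (hx : x ∈ S) :
    HasFDerivWithinAt f (fderivWithin ℝ f S x) S x :=
  (hf.contDiffOn_one.differentiableOn one_ne_zero x hx).hasFDerivWithinAt

theorem injective_fderivWithin (hf : IsScaledMap S k Λ h f) {x : E d} (hx : x ∈ S) :
    Function.Injective (fderivWithin ℝ f S x) := by
  refine (injective_iff_map_eq_zero _).2 fun v hv => ?_
  have h1 := hf.le_norm_fderivWithin x hx v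
  rw [hv, norm_zero, mul_zero] at h1
  exact norm_le_zero_iff.1 (nonpos_of_mul_nonpos_right h1 hf.scale_pos)

theorem isInvertible_fderivWithin (hf : IsScaledMap S k Λ h f) {x : E d} (hx : x ∈ S) :
    (fderivWithin ℝ f S x).IsInvertible :=
  isInvertible_of_injective (hf.injective_fderivWithin hx)

theorem inv_mem {y : E d} (hy : y ∈ f '' S) : Function.invFunOn f S y ∈ S :=
  Function.invFunOn_mem hy

theorem map_inv {y : E d} (hy : y ∈ f '' S) : f (Function.invFunOn f S y) = y :=
  Function.invFunOn_eq hy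

theorem inv_map (hf : IsScaledMap S k Λ h f) {x : E d} (hx : x ∈ S) :
    Function.invFunOn f S (f x) = x :=
  hf.injOn (inv_mem (mem_image_of_mem f hx)) hx (map_inv (mem_image_of_mem f hx))

theorem norm_inv_sub_le (hf : IsScaledMap S k Λ h f) {y z : E d} (hy : y ∈ f '' S)
    (hz : z ∈ f '' S) :
    h * ‖Function.invFunOn f S y - Function.invFunOn f S z‖ ≤ Λ * ‖y - z‖ := by
  have := hf.le_norm_sub _ (inv_mem hy) _ (inv_mem hz)
  rwa [map_inv hy, map_inv hz] at this

theorem lipschitzOnWith_inv (hf : IsScaledMap S k Λ h f) :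
    LipschitzOnWith (Λ / h).toNNReal (Function.invFunOn f S) (f '' S) := by
  refine LipschitzOnWith.of_dist_le_mul fun y hy z hz => ?_
  rw [Real.coe_toNNReal _ (div_nonneg hf.pos.le hf.scale_pos.le), dist_eq_norm, dist_eq_norm,
    div_mul_eq_mul_div, le_div_iff₀ hf.scale_pos, mul_comm]
  exact hf.norm_inv_sub_le hy hz

theorem lipschitzOnWith (hf : IsScaledMap S k Λ h f) : LipschitzOnWith (Λ * h).toNNReal f S := by
  refine LipschitzOnWith.of_dist_le_mul fun y hy z hz => ?_
  rw [Real.coe_toNNReal _ (mul_nonneg hf.pos.le hf.scale_pos.le), dist_eq_norm, dist_eq_norm]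
  exact hf.norm_sub_le y hy z hz

theorem continuousOn_inv (hf : IsScaledMap S k Λ h f) :
    ContinuousOn (Function.invFunOn f S) (f '' S) :=
  hf.lipschitzOnWith_inv.continuousOn

/-- The inverse map is differentiable up to the boundary. -/
theorem hasFDerivWithinAt_inv (hf : IsScaledMap S k Λ h f) {y : E d} (hy : y ∈ f '' S) :
    HasFDerivWithinAt (Function.invFunOn f S)
      (fderivWithin ℝ f S (Function.invFunOn f S y)).inverse (f '' S) y := by
  have hx := inv_mem hy
  refine (hf.hasFDerivWithinAt hx).of_comp_of_leftInverse (s := f '' S)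
    (f'symm := (fderivWithin ℝ f S (Function.invFunOn f S y)).inverse) ?_
    (hasFDerivWithinAt_id _ _) ?_ ?_ hy
  · exact tendsto_nhdsWithin_iff.2 ⟨hf.continuousOn_inv y hy,
      eventually_nhdsWithin_of_forall fun z hz => inv_mem hz⟩
  · exact eventually_nhdsWithin_of_forall fun z hz => map_inv hz
  · exact (hf.isInvertible_fderivWithin hx).inverse_apply_self

/-- The inverse map is of class `Cᵏ` up to the boundary: its derivative is the inverse of `Df`
composed with the inverse map itself, which allows an induction on the order. -/
theorem contDiffOn_inv (hf : IsScaledMap S k Λ h f) (hS : UniqueDiffOn ℝ S) :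
    ContDiffOn ℝ k (Function.invFunOn f S) (f '' S) := by
  suffices H : ∀ n : ℕ, n ≤ k → ContDiffOn ℝ n (Function.invFunOn f S) (f '' S) from H k le_rfl
  intro n
  induction n with
  | zero => exact fun _ => contDiffOn_zero.2 hf.continuousOn_inv
  | succ n ih =>
    intro hn
    rw [Nat.cast_add, Nat.cast_one, contDiffOn_succ_iff_hasFDerivWithinAt (by simp)]
    intro y hy
    refine ⟨f '' S, by rw [insert_eq_of_mem hy]; exact self_mem_nhdsWithin, by simp, _,
      fun z hz => hf.hasFDerivWithinAt_inv hz, ?_⟩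
    have h1 : ContDiffOn ℝ n (fderivWithin ℝ f S) S :=
      hf.contDiffOn.fderivWithin hS (by exact_mod_cast hn)
    have h2 := h1.comp (ih (by omega)) fun z hz => inv_mem hz
    intro z hz
    exact (hf.isInvertible_fderivWithin (inv_mem hz)).contDiffAt_map_inverse.comp_contDiffWithinAt z
      (h2 z hz)

end IsScaledMap

/-! ### Pulling tangential directions back to the reference element -/

section TangentInverse

variable {d : ℕ} (H : Submodule ℝ (E d))

/-- The Gram operator `(D|_H)ᵀ D|_H` of the restriction of `D` to `H`, extended by the identity on
the orthogonal complement of `H`. -/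
def gramOp (D : E d →L[ℝ] E d) : E d →L[ℝ] E d :=
  H.starProjection ∘L (ContinuousLinearMap.adjoint D ∘L (D ∘L H.starProjection)) +
    (ContinuousLinearMap.id ℝ (E d) - H.starProjection)

/-- The Moore-Penrose inverse of the restriction of `D` to `H`: it maps `e` to the vector of `H`
that `D` sends to the orthogonal projection of `e` to `D(H)`. -/
def tangentInverse (D : E d →L[ℝ] E d) : E d →L[ℝ] E d :=
  H.starProjection ∘L
    ((gramOp H D).inverse ∘L (H.starProjection ∘L ContinuousLinearMap.adjoint D))

variable {H}

theorem gramOp_apply (D : E d →L[ℝ] E d) (v : E d) :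
    gramOp H D v = H.starProjection (ContinuousLinearMap.adjoint D (D (H.starProjection v))) +
      (v - H.starProjection v) := rfl

theorem starProjection_gramOp (D : E d →L[ℝ] E d) (v : E d) :
    H.starProjection (gramOp H D v) =
      H.starProjection (ContinuousLinearMap.adjoint D (D (H.starProjection v))) := by
  have h : ∀ u, H.starProjection (H.starProjection u) = H.starProjection u := fun u =>
    Submodule.starProjection_eq_self_iff.2 (Submodule.starProjection_apply_mem H u)
  rw [gramOp_apply, map_add, map_sub, h, h, sub_self, add_zero]

theorem isInvertible_gramOp {D : E d →L[ℝ] E d} (hD : Function.Injective D) :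
    (gramOp H D).IsInvertible := by
  refine isInvertible_of_injective ((injective_iff_map_eq_zero _).2 fun v hv => ?_)
  have h1 : H.starProjection (ContinuousLinearMap.adjoint D (D (H.starProjection v))) = 0 := by
    rw [← starProjection_gramOp, hv, map_zero]
  have h2 : v = H.starProjection v := by
    rw [gramOp_apply, h1, zero_add] at hv
    exact sub_eq_zero.1 hv
  have h3 : inner ℝ (D v) (D v) = 0 := by
    rw [← ContinuousLinearMap.adjoint_inner_left]
    nth_rewrite 2 [h2]
    rw [← Submodule.inner_starProjection_left_eq_right]
    nth_rewrite 1 [h2]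
    rw [h1, inner_zero_left]
  exact hD ((inner_self_eq_zero.1 h3).trans (map_zero D).symm)

theorem tangentInverse_mem (D : E d →L[ℝ] E d) (e : E d) : tangentInverse H D e ∈ H :=
  Submodule.starProjection_apply_mem H _

theorem apply_tangentInverse {D : E d →L[ℝ] E d} (hD : Function.Injective D) (e : E d) :
    D (tangentInverse H D e) = (H.map D.toLinearMap).starProjection e := by
  refine (Submodule.eq_starProjection_of_mem_of_inner_eq_zero (K := H.map D.toLinearMap)
    (Submodule.mem_map_of_mem (f := D.toLinearMap) (tangentInverse_mem D e)) ?_).symm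
  rintro _ ⟨w, hw, rfl⟩
  change inner ℝ (e - D (tangentInverse H D e)) (D w) = 0
  rw [← ContinuousLinearMap.adjoint_inner_left, ← Submodule.starProjection_eq_self_iff.2 hw,
    ← Submodule.inner_starProjection_left_eq_right, map_sub, map_sub, inner_sub_left, sub_eq_zero]
  congr 1
  have h1 : H.starProjection (ContinuousLinearMap.adjoint D (D (tangentInverse H D e))) =
      H.starProjection (gramOp H D ((gramOp H D).inverse
        (H.starProjection (ContinuousLinearMap.adjoint D e)))) := by
    rw [starProjection_gramOp]
    rfl
  rw [h1, (isInvertible_gramOp hD).self_apply_inverse]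
  exact (Submodule.starProjection_eq_self_iff.2 (Submodule.starProjection_apply_mem H _)).symm

/-- `tangentInverse` scales like an inverse. -/
theorem apply_smul_tangentInverse {D : E d →L[ℝ] E d} (hD : Function.Injective D) {c : ℝ}
    (hc : c ≠ 0) (e : E d) :
    D (c • tangentInverse H (c • D) e) = (H.map D.toLinearMap).starProjection e := by
  have hcD : Function.Injective (c • D) := fun x y hxy => hD (smul_right_injective _ hc hxy)
  have h1 := apply_tangentInverse (H := H) hcD e
  have h2 : H.map (c • D).toLinearMap = H.map D.toLinearMap := Submodule.map_smul _ _ _ hc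
  rw [map_smul]
  change c • D (tangentInverse H (c • D) e) = _ at h1
  rw [h1]
  congr 2

variable (H)

theorem contDiff_adjoint {n : WithTop ℕ∞} :
    ContDiff ℝ n fun D : E d →L[ℝ] E d => ContinuousLinearMap.adjoint D := by
  refine IsBoundedLinearMap.contDiff
    (IsLinearMap.with_bound ⟨fun x y => map_add _ x y, fun c x => ?_⟩ 1 fun D => ?_)
  · rw [map_smulₛₗ]
    simp
  · rw [one_mul, LinearIsometryEquiv.norm_map]

theorem contDiff_gramOp {n : WithTop ℕ∞} : ContDiff ℝ n (gramOp H) := by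
  unfold gramOp
  exact (contDiff_const.clm_comp (contDiff_adjoint.clm_comp
    (contDiff_id.clm_comp contDiff_const))).add contDiff_const

theorem isOpen_isInvertible_gramOp : IsOpen {D : E d →L[ℝ] E d | (gramOp H D).IsInvertible} := by
  have : {D : E d →L[ℝ] E d | (gramOp H D).IsInvertible} =
      gramOp H ⁻¹' range ((↑) : (E d ≃L[ℝ] E d) → E d →L[ℝ] E d) := rfl
  rw [this]
  exact (ContinuousLinearEquiv.isOpen).preimage (contDiff_gramOp H (n := 0)).continuous

theorem contDiffOn_tangentInverse {n : WithTop ℕ∞} :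
    ContDiffOn ℝ n (tangentInverse H) {D | (gramOp H D).IsInvertible} := by
  intro D hD
  unfold tangentInverse
  refine ContDiffAt.contDiffWithinAt ?_
  have h1 : ContDiffAt ℝ n (fun D => (gramOp H D).inverse) D :=
    hD.contDiffAt_map_inverse.comp D (contDiff_gramOp H).contDiffAt
  exact contDiffAt_const.clm_comp (h1.clm_comp (contDiffAt_const.clm_comp
    contDiff_adjoint.contDiffAt))

/-- On operators that are bounded from above and below, the derivatives of `tangentInverse` are
bounded, by compactness. -/
theorem exists_norm_iteratedFDerivWithin_tangentInverse_le (k : ℕ) (Λ : ℝ) :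
    ∃ C : ℝ, ∀ n ≤ k, ∀ D : E d →L[ℝ] E d, ‖D‖ ≤ Λ → (∀ v, ‖v‖ ≤ Λ * ‖D v‖) →
      ‖iteratedFDerivWithin ℝ n (tangentInverse H) {D | (gramOp H D).IsInvertible} D‖ ≤ C := by
  have hU := isOpen_isInvertible_gramOp H
  set U : Set (E d →L[ℝ] E d) := {D | (gramOp H D).IsInvertible} with hU'
  let Q : Set (E d →L[ℝ] E d) := {D | ‖D‖ ≤ Λ} ∩ {D | ∀ v, ‖v‖ ≤ Λ * ‖D v‖}
  have hQc : IsCompact Q := by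
    refine Metric.isCompact_of_isClosed_isBounded ?_
      ((Metric.isBounded_closedBall (x := (0 : E d →L[ℝ] E d)) (r := Λ)).subset fun D hD => by
        exact mem_closedBall_zero_iff.2 hD.1)
    refine (isClosed_le continuous_norm continuous_const).inter ?_
    have : {D : E d →L[ℝ] E d | ∀ v, ‖v‖ ≤ Λ * ‖D v‖} = ⋂ v, {D | ‖v‖ ≤ Λ * ‖D v‖} := by
      ext; simp
    rw [this]
    exact isClosed_iInter fun v => isClosed_le (by fun_prop) (by fun_prop)
  have hQU : Q ⊆ U := by
    intro D hD
    refine isInvertible_gramOp ((injective_iff_map_eq_zero _).2 fun v hv => ?_)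
    have := hD.2 v
    rw [hv, norm_zero, mul_zero] at this
    exact norm_le_zero_iff.1 this
  have hb : ∀ n : ℕ, ∃ C : ℝ, ∀ D ∈ Q, ‖iteratedFDerivWithin ℝ n (tangentInverse H) U D‖ ≤ C :=
    fun n => hQc.exists_bound_of_continuousOn
      (((contDiffOn_tangentInverse H (n := n)).continuousOn_iteratedFDerivWithin le_rfl
        hU.uniqueDiffOn).mono hQU)
  choose C hC using hb
  refine ⟨∑ n ∈ Finset.range (k + 1), |C n|, fun n hn D h1 h2 => (hC n D ⟨h1, h2⟩).trans ?_⟩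
  exact (le_abs_self _).trans (Finset.single_le_sum (f := fun n => |C n|)
    (fun i _ => abs_nonneg _) (Finset.mem_range.2 (by omega)))

end TangentInverse

/-! ### Tangential derivatives in reference coordinates -/

section RefDeriv

variable {d k : ℕ} {S : Set (E d)} {Λ h : ℝ} {f : E d → E d}

/-- The field of operators that send a direction `e` to `h` times the reference vector in `H` which
`Df` maps to the tangential part of `e`. -/
def pullbackField (S : Set (E d)) (H : Submodule ℝ (E d)) (h : ℝ) (f : E d → E d) (x : E d) :
    E d →L[ℝ] E d :=
  tangentInverse H (h⁻¹ • fderivWithin ℝ f S x)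

/-- The component in the direction `e` of the tangential gradient, transported to the reference
element and multiplied by `h`. -/
def refDeriv (S : Set (E d)) (H : Submodule ℝ (E d)) (h : ℝ) (f : E d → E d) (e : E d)
    (u : E d → ℝ) (x : E d) : ℝ :=
  fderivWithin ℝ u S x (pullbackField S H h f x e)

/-- Iterated components of the transported and rescaled tangential gradient. -/
def iterRefDeriv (S : Set (E d)) (H : Submodule ℝ (E d)) (h : ℝ) (f : E d → E d) :
    List (Fin d) → (E d → ℝ) → E d → ℝ
  | [], u => u
  | i :: α, u => refDeriv S H h f (EuclideanSpace.single i 1) (iterRefDeriv S H h f α u)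

theorem IsScaledMap.contDiffOn_pullbackField (hf : IsScaledMap S k Λ h f) (hS : UniqueDiffOn ℝ S)
    (H : Submodule ℝ (E d)) {n : ℕ} (hn : n + 1 ≤ k) :
    ContDiffOn ℝ n (pullbackField S H h f) S := by
  have h1 : ContDiffOn ℝ n (h⁻¹ • fderivWithin ℝ f S) S :=
    contDiffOn_const.smul (hf.contDiffOn.fderivWithin hS (by exact_mod_cast hn))
  refine (contDiffOn_tangentInverse H).comp h1 fun x hx => isInvertible_gramOp ?_
  exact fun v w hvw => hf.injective_fderivWithin hx
    (smul_right_injective _ (inv_ne_zero hf.scale_pos.ne') hvw)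

/-- The derivatives of the pulled back directions are bounded independently of the size `h`. -/
theorem exists_norm_iteratedFDerivWithin_pullbackField_le (hS : UniqueDiffOn ℝ S)
    (H : Submodule ℝ (E d)) (k : ℕ) (Λ : ℝ) :
    ∃ C : ℝ, 0 ≤ C ∧ ∀ (h : ℝ) (f : E d → E d), IsScaledMap S k Λ h f → ∀ n, n + 1 ≤ k →
      ∀ x ∈ S, ‖iteratedFDerivWithin ℝ n (pullbackField S H h f) S x‖ ≤ C := by
  obtain ⟨C, hC⟩ := exists_norm_iteratedFDerivWithin_tangentInverse_le H k Λ
  refine ⟨k.factorial * |C| * max Λ 1 ^ k, by positivity, fun h f hf n hn x hx => ?_⟩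
  have hh := hf.scale_pos
  have h1 : ContDiffOn ℝ n (h⁻¹ • fderivWithin ℝ f S) S :=
    contDiffOn_const.smul (hf.contDiffOn.fderivWithin hS (by exact_mod_cast hn))
  have hinj : ∀ x ∈ S, Function.Injective (h⁻¹ • fderivWithin ℝ f S x) := fun x hx v w hvw =>
    hf.injective_fderivWithin hx (smul_right_injective _ (inv_ne_zero hh.ne') hvw)
  have key := norm_iteratedFDerivWithin_comp_le (n := n) (x := x) (C := |C|) (D := max Λ 1)
    (contDiffOn_tangentInverse H (n := n)) h1 le_rfl (isOpen_isInvertible_gramOp H).uniqueDiffOn hS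
    (fun x hx => isInvertible_gramOp (hinj x hx)) hx ?_ ?_
  · refine key.trans ?_
    have h2 : (n.factorial : ℝ) ≤ k.factorial := by
      exact_mod_cast Nat.factorial_le (by omega)
    have h3 : max Λ 1 ^ n ≤ max Λ 1 ^ k := pow_le_pow_right₀ (le_max_right _ _) (by omega)
    gcongr
  · intro i hi
    refine (hC i (by omega) _ ?_ fun v => ?_).trans (le_abs_self C)
    · rw [Pi.smul_apply, norm_smul, norm_inv, Real.norm_of_nonneg hh.le, inv_mul_le_iff₀ hh,
        mul_comm]
      exact hf.norm_fderivWithin_le x hx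
    · change _ ≤ Λ * ‖h⁻¹ • fderivWithin ℝ f S x v‖
      rw [norm_smul, norm_inv, Real.norm_of_nonneg hh.le, mul_left_comm, le_inv_mul_iff₀ hh]
      exact hf.le_norm_fderivWithin x hx v
  · intro i hi1 hin
    have h4 : ContDiffOn ℝ i (fderivWithin ℝ f S) S :=
      hf.contDiffOn.fderivWithin hS (by exact_mod_cast (by omega : i + 1 ≤ k))
    rw [iteratedFDerivWithin_const_smul_apply (h4 x hx) hS hx, norm_smul, norm_inv,
      Real.norm_of_nonneg hh.le, norm_iteratedFDerivWithin_fderivWithin hS hx, inv_mul_le_iff₀ hh]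
    calc ‖iteratedFDerivWithin ℝ (i + 1) f S x‖ ≤ Λ * h :=
          hf.norm_iteratedFDerivWithin_le _ (by omega) (by omega) x hx
      _ ≤ h * max Λ 1 ^ i := by
          rw [mul_comm]
          gcongr
          exact (le_max_left _ _).trans (le_self_pow₀ (le_max_right _ _) (by omega))

theorem IsScaledMap.contDiffOn_refDeriv (hf : IsScaledMap S k Λ h f) (hS : UniqueDiffOn ℝ S)
    (H : Submodule ℝ (E d)) {n : ℕ} (hn : n + 1 ≤ k) (e : E d) {u : E d → ℝ}
    (hu : ContDiffOn ℝ (n + 1 : ℕ) u S) : ContDiffOn ℝ n (refDeriv S H h f e u) S :=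
  (hu.fderivWithin hS (by norm_cast)).clm_apply
    ((hf.contDiffOn_pullbackField hS H hn).clm_apply contDiffOn_const)

theorem IsScaledMap.contDiffOn_iterRefDeriv (hf : IsScaledMap S k Λ h f) (hS : UniqueDiffOn ℝ S)
    (H : Submodule ℝ (E d)) {u : E d → ℝ} (hu : ContDiffOn ℝ k u S) (α : List (Fin d)) :
    ∀ n : ℕ, n + α.length ≤ k → ContDiffOn ℝ n (iterRefDeriv S H h f α u) S := by
  induction α with
  | nil => exact fun n hn => hu.of_le (by exact_mod_cast hn)
  | cons i α ih =>
    intro n hn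
    rw [List.length_cons] at hn
    exact hf.contDiffOn_refDeriv hS H (by omega) _ (ih (n + 1) (by omega))

/-- Iterated tangential derivatives on the reference element are bounded by the derivatives of the
function, independently of the size `h`. -/
theorem exists_norm_iteratedFDerivWithin_iterRefDeriv_le (hS : UniqueDiffOn ℝ S)
    (H : Submodule ℝ (E d)) (k : ℕ) (Λ : ℝ) :
    ∃ C : ℝ, 1 ≤ C ∧ ∀ (h : ℝ) (f : E d → E d), IsScaledMap S k Λ h f →
      ∀ (u : E d → ℝ) (N : ℝ), ContDiffOn ℝ k u S →
        (∀ j ≤ k, ∀ x ∈ S, ‖iteratedFDerivWithin ℝ j u S x‖ ≤ N) →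
        ∀ (α : List (Fin d)) (j : ℕ), j + α.length ≤ k → ∀ x ∈ S,
          ‖iteratedFDerivWithin ℝ j (iterRefDeriv S H h f α u) S x‖ ≤ C ^ α.length * N := by
  obtain ⟨C, hC0, hC⟩ := exists_norm_iteratedFDerivWithin_pullbackField_le hS H k Λ
  have h2C : 2 ^ k * C ≤ max (2 ^ k * C) 1 := le_max_left _ _
  refine ⟨max (2 ^ k * C) 1, le_max_right _ _, fun h f hf u N hu hN α => ?_⟩
  set C' := max (2 ^ k * C) 1
  have hC' : 0 ≤ C' := zero_le_one.trans (le_max_right _ _)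
  induction α with
  | nil =>
    intro j hj x hx
    rw [List.length_nil, pow_zero, one_mul]
    exact hN j hj x hx
  | cons i α ih =>
    intro j hj x hx
    rw [List.length_cons] at hj
    have hN0 : 0 ≤ N := (norm_nonneg _).trans (hN 0 (Nat.zero_le _) x hx)
    have hw : ContDiffOn ℝ (j + 1 : ℕ) (iterRefDeriv S H h f α u) S :=
      hf.contDiffOn_iterRefDeriv hS H hu α (j + 1) (by omega)
    have hV := hf.contDiffOn_pullbackField hS H (n := j) (by omega)
    refine (norm_iteratedFDerivWithin_clm_apply (N := j) (n := j)
      (hw.fderivWithin hS (by norm_cast)) (hV.clm_apply contDiffOn_const) hS hx le_rfl).trans ?_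
    have hV' : ∀ n ≤ j, ‖iteratedFDerivWithin ℝ n
        (fun y => pullbackField S H h f y (EuclideanSpace.single i 1)) S x‖ ≤ C := fun n hn => by
      refine (norm_iteratedFDerivWithin_clm_apply_const (N := j) (n := n) (hV x hx) hS hx
        (by exact_mod_cast hn)).trans ?_
      rw [PiLp.norm_single, norm_one, one_mul]
      exact hC h f hf n (by omega) x hx
    calc ∑ n ∈ Finset.range (j + 1), (j.choose n : ℝ) *
          ‖iteratedFDerivWithin ℝ n (fderivWithin ℝ (iterRefDeriv S H h f α u) S) S x‖ *
          ‖iteratedFDerivWithin ℝ (j - n)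
            (fun y => pullbackField S H h f y (EuclideanSpace.single i 1)) S x‖
        ≤ ∑ n ∈ Finset.range (j + 1), (j.choose n : ℝ) * (C' ^ α.length * N) * C := by
          refine Finset.sum_le_sum fun n hn => ?_
          rw [Finset.mem_range] at hn
          rw [norm_iteratedFDerivWithin_fderivWithin hS hx]
          gcongr
          · exact ih (n + 1) (by omega) x hx
          · exact hV' _ (by omega)
      _ = 2 ^ j * C * (C' ^ α.length * N) := by
          rw [← Finset.sum_mul, ← Finset.sum_mul]
          have := Nat.sum_range_choose j
          rw [← Nat.cast_sum, this]
          push_cast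
          ring
      _ ≤ C' * (C' ^ α.length * N) := by
          gcongr
          refine le_trans ?_ h2C
          gcongr
          · norm_num
          · omega
      _ = C' ^ (i :: α).length * N := by
          rw [List.length_cons, pow_succ]
          ring

end RefDeriv

/-! ### The tangential gradient on a curved face -/

section Tangential

variable {d k : ℕ} {S A F : Set (E d)} {ℓ : E d →L[ℝ] ℝ} {a Λ h : ℝ} {f : E d → E d}

theorem IsFlatFacet.ker_subset_span_tangentConeAt (hA : IsFlatFacet S A ℓ a) {x : E d}
    (hx : x ∈ A) {v : E d} (hv : ℓ v = 0) : v ∈ Submodule.span ℝ (tangentConeAt ℝ A x) := by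
  obtain ⟨r, hr, hrA⟩ := hA.exists_ball hx
  obtain ⟨t, ht, htr⟩ : ∃ t : ℝ, 0 < t ∧ t * ‖v‖ < r := by
    refine ⟨r / (2 * (‖v‖ + 1)), by positivity, ?_⟩
    rw [div_mul_eq_mul_div, div_lt_iff₀ (by positivity)]
    nlinarith [norm_nonneg v]
  have h1 : x + t • v ∈ A := hrA _ (by simp [hv]) (by
    rwa [add_sub_cancel_left, norm_smul, Real.norm_of_nonneg ht.le])
  have h2 := mem_tangentConeAt_of_segment_subset (hA.convex.segment_subset hx h1)
  rw [add_sub_cancel_left] at h2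
  have h3 := Submodule.smul_mem _ t⁻¹ (Submodule.subset_span (R := ℝ) h2)
  rwa [smul_smul, inv_mul_cancel₀ ht.ne', one_smul] at h3

/-- The tangent space of a curved face is the image under `Df` of the direction of the flat
facet. -/
theorem IsScaledMap.tangentSpaceAt_eq (hf : IsScaledMap S k Λ h f) (hA : IsFlatFacet S A ℓ a)
    (hFA : F ⊆ f '' A) {x : E d} (hx : x ∈ A) (hFx : F ∈ 𝓝[f '' A] f x) :
    tangentSpaceAt F (f x) =
      (LinearMap.ker ℓ.toLinearMap).map (fderivWithin ℝ f S x).toLinearMap := by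
  have hxS := hA.subset hx
  have hcone : tangentConeAt ℝ F (f x) = tangentConeAt ℝ (f '' A) (f x) :=
    tangentConeAt_congr (le_antisymm (nhdsWithin_mono _ hFA) (nhdsWithin_le_of_mem hFx))
  rw [tangentSpaceAt, hcone]
  refine le_antisymm (Submodule.span_le.2 fun v hv => ?_) ?_
  · -- `ℓ ∘ f⁻¹` is constant on the face, so its derivative vanishes on the tangent cone
    have hinv := (hf.hasFDerivWithinAt_inv (mem_image_of_mem f hxS)).mono (image_mono hA.subset)
    rw [hf.inv_map hxS] at hinv
    have h1 := ℓ.hasFDerivAt.comp_hasFDerivWithinAt _ hinv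
    have h2 : HasFDerivWithinAt (ℓ ∘ Function.invFunOn f S) (0 : E d →L[ℝ] ℝ) (f '' A) (f x) := by
      refine (hasFDerivWithinAt_const a (f x) (f '' A)).congr' ?_ (mem_image_of_mem f hx)
      rintro _ ⟨y, hy, rfl⟩
      rw [Function.comp_apply, hf.inv_map (hA.subset hy), hA.apply_eq hy]
    have h3 := h1.unique_on h2 hv
    exact ⟨(fderivWithin ℝ f S x).inverse v, h3,
      (hf.isInvertible_fderivWithin hxS).self_apply_inverse v⟩
  · rw [Submodule.map_le_iff_le_comap]
    intro v hv
    have h1 := ((hf.hasFDerivWithinAt hxS).mono hA.subset).mapsTo_tangent_cone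
    have h2 : Submodule.span ℝ (tangentConeAt ℝ A x) ≤
        (Submodule.span ℝ (tangentConeAt ℝ (f '' A) (f x))).comap
          (fderivWithin ℝ f S x).toLinearMap :=
      Submodule.span_le.2 fun w hw => Submodule.subset_span (h1 hw)
    exact h2 (hA.ker_subset_span_tangentConeAt hx hv)

/-- The tangential derivative of a function given in reference coordinates. -/
theorem IsScaledMap.tangentialDeriv_eq (hf : IsScaledMap S k Λ h f) (hA : IsFlatFacet S A ℓ a)
    (hFA : F ⊆ f '' A) {x : E d} (hx : x ∈ A) (hxF : f x ∈ F) (hFx : F ∈ 𝓝[f '' A] f x)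
    {w g : E d → ℝ} {c : ℝ} (hw : DifferentiableWithinAt ℝ w S x)
    (hg : ∀ y ∈ F, g y = c * w (Function.invFunOn f S y)) (e : E d) :
    tangentialDeriv F e g (f x) =
      c * (h⁻¹ * refDeriv S (LinearMap.ker ℓ.toLinearMap) h f e w x) := by
  have hxS := hA.subset hx
  have hh := hf.scale_pos
  have hFS : F ⊆ f '' S := hFA.trans (image_mono hA.subset)
  have hinv := (hf.hasFDerivWithinAt_inv (mem_image_of_mem f hxS)).mono hFS
  rw [hf.inv_map hxS] at hinv
  have hw' : HasFDerivWithinAt w (fderivWithin ℝ w S x) S (Function.invFunOn f S (f x)) := by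
    rw [hf.inv_map hxS]
    exact hw.hasFDerivWithinAt
  have h1 : HasFDerivWithinAt g
      (c • (fderivWithin ℝ w S x ∘L (fderivWithin ℝ f S x).inverse)) F (f x) :=
    ((hw'.comp (f x) hinv fun y hy => inv_mem (hFS hy)).const_smul c).congr'
      (fun y hy => hg y hy) hxF
  have h2 := h1.differentiableWithinAt.hasFDerivWithinAt
  have h3 : ∀ v ∈ tangentSpaceAt F (f x), fderivWithin ℝ g F (f x) v =
      (c • (fderivWithin ℝ w S x ∘L (fderivWithin ℝ f S x).inverse)) v := fun v hv =>
    LinearMap.eqOn_span (f := (fderivWithin ℝ g F (f x)).toLinearMap)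
      (g := (c • (fderivWithin ℝ w S x ∘L (fderivWithin ℝ f S x).inverse)).toLinearMap)
      (h2.unique_on h1) hv
  rw [tangentialDeriv, h3 _ (Submodule.starProjection_apply_mem _ _)]
  have h4 : (tangentSpaceAt F (f x)).starProjection e = fderivWithin ℝ f S x
      (h⁻¹ • pullbackField S (LinearMap.ker ℓ.toLinearMap) h f x e) := by
    rw [pullbackField, apply_smul_tangentInverse (hf.injective_fderivWithin hxS)
      (inv_ne_zero hh.ne')]
    simp only [hf.tangentSpaceAt_eq hA hFA hx hFx]
  rw [h4]
  change c * fderivWithin ℝ w S x ((fderivWithin ℝ f S x).inverse (fderivWithin ℝ f S x _)) = _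
  rw [(hf.isInvertible_fderivWithin hxS).inverse_apply_self, map_smul]
  rfl

theorem IsScaledMap.iterTangentialDeriv_eq (hf : IsScaledMap S k Λ h f) (hS : UniqueDiffOn ℝ S)
    (hA : IsFlatFacet S A ℓ a) (hFA : F ⊆ f '' A) (hF : ∀ y ∈ F, F ∈ 𝓝[f '' A] y)
    {u : E d → ℝ} (hu : ContDiffOn ℝ k u S) (α : List (Fin d)) (hα : α.length ≤ k) :
    ∀ y ∈ F, iterTangentialDeriv F α (u ∘ Function.invFunOn f S) y =
      h⁻¹ ^ α.length *
        iterRefDeriv S (LinearMap.ker ℓ.toLinearMap) h f α u (Function.invFunOn f S y) := by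
  induction α with
  | nil =>
    intro y hy
    rw [List.length_nil, pow_zero, one_mul]
    rfl
  | cons i α ih =>
    rw [List.length_cons] at hα
    intro y hy
    obtain ⟨x, hx, rfl⟩ := hFA hy
    have hw := (hf.contDiffOn_iterRefDeriv hS (LinearMap.ker ℓ.toLinearMap) hu α 1
      (by omega)).differentiableOn (by simp) x (hA.subset hx)
    rw [iterTangentialDeriv, hf.tangentialDeriv_eq hA hFA hx hy (hF _ hy) hw (ih (by omega)),
      hf.inv_map (hA.subset hx), List.length_cons, pow_succ, mul_assoc]
    rfl

end Tangential

/-! ### Polynomials on a flat facet -/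

section Polynomials

variable {d p : ℕ}

/-- The polynomial function with coefficients `c`, of degree at most `p` in each variable. -/
def polyFun (c : (Fin d → Fin (p + 1)) → ℝ) (x : E d) : ℝ :=
  ∑ s, c s * ∏ i, x i ^ (s i : ℕ)

/-- Both notions of degree bound the degree in each single variable. -/
theorem exists_eval_eq_polyFun {κ : DegreeKind} {ρ : MvPolynomial (Fin d) ℝ}
    (hρ : ρ ∈ polySpace d p κ) :
    ∃ c : (Fin d → Fin (p + 1)) → ℝ, ∀ x : E d,
      MvPolynomial.eval (fun i => x i) ρ = polyFun c x := by
  have hdeg : ∀ i, ρ.degreeOf i ≤ p := by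
    cases κ
    · exact fun i => (MvPolynomial.degreeOf_le_totalDegree ρ i).trans hρ
    · exact hρ
  let φ : (Fin d → Fin (p + 1)) → (Fin d →₀ ℕ) := fun s =>
    Finsupp.equivFunOnFinite.symm fun i => (s i : ℕ)
  have hφ : Function.Injective φ := fun s t hst => by
    funext i
    exact Fin.ext (DFunLike.congr_fun hst i)
  refine ⟨fun s => ρ.coeff (φ s), fun x => ?_⟩
  rw [MvPolynomial.eval_eq', polyFun]
  have h1 : ∑ s, ρ.coeff (φ s) * ∏ i, x i ^ (s i : ℕ) =
      ∑ m ∈ Finset.univ.image φ, ρ.coeff m * ∏ i, x i ^ m i := by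
    rw [Finset.sum_image fun s _ t _ h => hφ h]
    rfl
  rw [h1]
  refine Finset.sum_subset (fun m hm => ?_) fun m _ hm => ?_
  · refine Finset.mem_image.2 ⟨fun i => ⟨m i, ?_⟩, Finset.mem_univ _, ?_⟩
    · have := MvPolynomial.monomial_le_degreeOf i hm
      have := hdeg i
      omega
    · ext i
      rfl
  · rw [MvPolynomial.notMem_support_iff.1 hm, zero_mul]

theorem contDiff_polyFun (c : (Fin d → Fin (p + 1)) → ℝ) {n : WithTop ℕ∞} :
    ContDiff ℝ n (polyFun c) := by
  unfold polyFun
  refine ContDiff.sum fun s _ => contDiff_const.mul (contDiff_prod fun i _ => ?_)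
  exact ((EuclideanSpace.proj i : E d →L[ℝ] ℝ).contDiff).pow _

theorem polyFun_sub (c c' : (Fin d → Fin (p + 1)) → ℝ) (x : E d) :
    polyFun (c - c') x = polyFun c x - polyFun c' x := by
  simp [polyFun, sub_mul, Finset.sum_sub_distrib]

theorem exists_norm_iteratedFDerivWithin_polyFun_le {S : Set (E d)} (hS : UniqueDiffOn ℝ S)
    (hSc : IsCompact S) (k p : ℕ) :
    ∃ C : ℝ, 0 ≤ C ∧ ∀ c : (Fin d → Fin (p + 1)) → ℝ, ∀ j ≤ k, ∀ x ∈ S,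
      ‖iteratedFDerivWithin ℝ j (polyFun c) S x‖ ≤ C * ‖c‖ := by
  let m : (Fin d → Fin (p + 1)) → E d → ℝ := fun s x => ∏ i, x i ^ (s i : ℕ)
  have hm : ∀ s {n : WithTop ℕ∞}, ContDiff ℝ n (m s) := fun s n =>
    contDiff_prod fun i _ => ((EuclideanSpace.proj i : E d →L[ℝ] ℝ).contDiff).pow _
  have hb : ∀ (s : Fin d → Fin (p + 1)) (j : ℕ),
      ∃ C : ℝ, ∀ x ∈ S, ‖iteratedFDerivWithin ℝ j (m s) S x‖ ≤ C := fun s j =>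
    hSc.exists_bound_of_continuousOn
      ((hm s (n := j)).contDiffOn.continuousOn_iteratedFDerivWithin le_rfl hS)
  choose C hC using hb
  refine ⟨∑ s, ∑ j ∈ Finset.range (k + 1), |C s j|, by positivity, fun c j hj x hx => ?_⟩
  have h1 : polyFun c = ∑ s, c s • m s := by
    ext x
    simp [polyFun, m]
  have h2 : ∀ s ∈ Finset.univ, ContDiffWithinAt ℝ j (c s • m s) S x := fun s _ =>
    ((hm s).const_smul (c s)).contDiffWithinAt
  rw [h1, iteratedFDerivWithin_sum_apply hS hx h2, Finset.sum_mul]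
  refine (norm_sum_le _ _).trans (Finset.sum_le_sum fun s _ => ?_)
  rw [iteratedFDerivWithin_const_smul_apply (hm s).contDiffWithinAt hS hx, norm_smul, mul_comm]
  gcongr
  · refine ((hC s j x hx).trans (le_abs_self _)).trans
      (Finset.single_le_sum (f := fun j => |C s j|) (fun i _ => abs_nonneg _)
        (Finset.mem_range.2 (by omega)))
  · exact norm_le_pi_norm c s

theorem exists_norm_polyFun_sub_le {S : Set (E d)} (hS : UniqueDiffOn ℝ S)
    (hSc : IsCompact S) (hSv : Convex ℝ S) (p : ℕ) :
    ∃ L : ℝ, 0 ≤ L ∧ ∀ c : (Fin d → Fin (p + 1)) → ℝ, ∀ x ∈ S, ∀ y ∈ S,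
      |polyFun c x - polyFun c y| ≤ L * ‖c‖ * ‖x - y‖ := by
  obtain ⟨L, hL0, hL⟩ := exists_norm_iteratedFDerivWithin_polyFun_le hS hSc 1 p
  refine ⟨L, hL0, fun c x hx y hy => ?_⟩
  refine hSv.norm_image_sub_le_of_norm_hasFDerivWithin_le (𝕜 := ℝ)
    (f' := fderivWithin ℝ (polyFun c) S) (fun z hz => ?_) (fun z hz => ?_) hy hx
  · exact ((contDiff_polyFun c (n := 1)).differentiable one_ne_zero
      z).differentiableWithinAt.hasFDerivWithinAt
  · rw [← norm_iteratedFDerivWithin_one (𝕜 := ℝ) _ (hS z hz)]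
    exact hL c 1 le_rfl z hz

/-- Identity theorem: a polynomial that vanishes near `z` on a hyperplane vanishes on the whole
hyperplane. -/
theorem polyFun_eq_zero_of_forall_ball (c : (Fin d → Fin (p + 1)) → ℝ) (ℓ : E d →L[ℝ] ℝ) (z : E d)
    {r : ℝ} (hr : 0 < r) (hc : ∀ y, ℓ (y - z) = 0 → ‖y - z‖ ≤ r → polyFun c y = 0) (y : E d)
    (hy : ℓ (y - z) = 0) : polyFun c y = 0 := by
  let q : ℝ → ℝ := fun t => polyFun c (z + t • (y - z))
  have hq : AnalyticOnNhd ℝ q univ := by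
    intro t _
    simp only [q, polyFun, PiLp.add_apply, PiLp.smul_apply, PiLp.sub_apply, smul_eq_mul]
    fun_prop
  have h0 : q =ᶠ[𝓝 0] fun _ => 0 := by
    have h1 : Tendsto (fun t : ℝ => ‖t • (y - z)‖) (𝓝 0) (𝓝 0) := by
      have : Continuous fun t : ℝ => ‖t • (y - z)‖ := by fun_prop
      simpa using this.tendsto 0
    filter_upwards [h1.eventually_lt_const hr] with t ht
    exact hc _ (by rw [add_sub_cancel_left, map_smul, hy, smul_zero])
      (by rw [add_sub_cancel_left]; exact ht.le)
  have h2 := congrFun (hq.eq_of_eventuallyEq analyticOnNhd_const h0) 1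
  simpa [q] using h2

theorem exists_linearMap_norm_le {V W : Type*} [NormedAddCommGroup V] [NormedSpace ℝ V]
    [FiniteDimensional ℝ V] [NormedAddCommGroup W] [NormedSpace ℝ W] (g : V →ₗ[ℝ] W) :
    ∃ C : ℝ, 0 ≤ C ∧ ∀ v, ‖g v‖ ≤ C * ‖v‖ :=
  ⟨‖LinearMap.toContinuousLinearMap g‖, norm_nonneg _,
    (LinearMap.toContinuousLinearMap g).le_opNorm⟩

/-- Norm equivalence on the finite-dimensional space of restrictions of polynomials to a ball of a
hyperplane: after a change of coefficients that does not alter the values on the hyperplane, the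
coefficients are bounded by one value on the ball. -/
theorem exists_polyFun_norm_le (p : ℕ) (ℓ : E d →L[ℝ] ℝ) (z : E d) {r : ℝ} (hr : 0 < r) :
    ∃ C : ℝ, ∀ c : (Fin d → Fin (p + 1)) → ℝ, ∃ c' : (Fin d → Fin (p + 1)) → ℝ,
      (∀ y, ℓ (y - z) = 0 → polyFun c' y = polyFun c y) ∧
        ∃ x, ℓ (x - z) = 0 ∧ ‖x - z‖ ≤ r ∧ ‖c'‖ ≤ C * |polyFun c' x| := by
  let Q : Set (E d) := {y | ℓ (y - z) = 0} ∩ Metric.closedBall z r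
  have hQ : IsCompact Q := (isCompact_closedBall z r).inter_left
    (isClosed_eq (by fun_prop) continuous_const)
  have : CompactSpace Q := isCompact_iff_compactSpace.1 hQ
  let R : ((Fin d → Fin (p + 1)) → ℝ) →ₗ[ℝ] C(Q, ℝ) :=
    { toFun := fun c => ⟨fun y => polyFun c y,
        (contDiff_polyFun c (n := 0)).continuous.comp continuous_subtype_val⟩
      map_add' := fun c c' => by
        ext y
        simp [polyFun, add_mul, Finset.sum_add_distrib]
      map_smul' := fun a c => by
        ext y
        simp [polyFun, mul_assoc, Finset.mul_sum] }
  obtain ⟨g, hg⟩ := R.rangeRestrict.exists_rightInverse_of_surjective R.range_rangeRestrict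
  obtain ⟨C, hC0, hC⟩ := exists_linearMap_norm_le (V := R.range) g
  refine ⟨C, fun c => ⟨g (R.rangeRestrict c), ?_, ?_⟩⟩
  · have hRg : R (g (R.rangeRestrict c)) = R c :=
      congrArg Subtype.val (DFunLike.congr_fun hg (R.rangeRestrict c))
    intro y hy
    rw [← sub_eq_zero, ← polyFun_sub]
    refine polyFun_eq_zero_of_forall_ball _ ℓ z hr (fun w hw hwr => ?_) y hy
    rw [polyFun_sub, sub_eq_zero]
    exact DFunLike.congr_fun hRg (⟨w, hw, mem_closedBall_iff_norm.2 hwr⟩ : Q)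
  · have hRg : R (g (R.rangeRestrict c)) = R c :=
      congrArg Subtype.val (DFunLike.congr_fun hg (R.rangeRestrict c))
    have hne : Q.Nonempty := ⟨z, by simp, by simp [hr.le]⟩
    obtain ⟨x, hx, hmax⟩ := hQ.exists_isMaxOn hne
      (contDiff_polyFun (g (R.rangeRestrict c)) (n := 0)).continuous.abs.continuousOn
    refine ⟨x, hx.1, mem_closedBall_iff_norm.1 hx.2, ?_⟩
    have h1 : ‖R.rangeRestrict c‖ ≤ |polyFun (g (R.rangeRestrict c)) x| := by
      change ‖R c‖ ≤ _
      rw [← hRg]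
      refine (ContinuousMap.norm_le _ (abs_nonneg _)).2 fun y => hmax y.2
    exact (hC _).trans (mul_le_mul_of_nonneg_left h1 hC0)

end Polynomials

section FacetPolynomials

variable {d : ℕ} {S A : Set (E d)} {ℓ : E d →L[ℝ] ℝ} {a : ℝ}

/-- A flat facet contains, near each of its points, hyperplane balls of a fixed radius. -/
theorem IsFlatFacet.exists_uniform_ball (hA : IsFlatFacet S A ℓ a) (hS : IsCompact S) {δ : ℝ}
    (hδ : 0 < δ) : ∃ r > 0, ∀ x ∈ A, ∃ z ∈ A, ∀ y, ℓ (y - z) = 0 → ‖y - z‖ < r →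
      y ∈ A ∧ dist y x < δ := by
  rcases A.eq_empty_or_nonempty with h | ⟨z₀, hz₀⟩
  · exact ⟨1, one_pos, fun x hx => by simp [h] at hx⟩
  obtain ⟨r, hr, hrA⟩ := hA.exists_ball hz₀
  obtain ⟨D, hD⟩ := (hS.isBounded.subset hA.subset).subset_closedBall z₀
  have hD0 : 0 ≤ D := dist_nonneg.trans (Metric.mem_closedBall.1 (hD hz₀))
  -- contract the facet towards `x` by the factor `t`
  set t : ℝ := min 1 (δ / (D + r)) with ht
  have ht0 : 0 < t := lt_min one_pos (by positivity)
  have ht1 : t ≤ 1 := min_le_left _ _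
  have htδ : t * (D + r) ≤ δ := by
    rw [← le_div_iff₀ (by positivity)]
    exact min_le_right _ _
  have hmem : ∀ x ∈ A, ∀ y, ℓ (y - (x + t • (z₀ - x))) = 0 →
      ‖y - (x + t • (z₀ - x))‖ < t * r → y ∈ A := by
    intro x hx y hy hyr
    have h1 : z₀ + t⁻¹ • (y - (x + t • (z₀ - x))) ∈ A := by
      refine hrA _ ?_ ?_
      · rw [add_sub_cancel_left, map_smul, hy, smul_zero]
      · rw [add_sub_cancel_left, norm_smul, norm_inv, Real.norm_of_nonneg ht0.le,
          inv_mul_lt_iff₀ ht0]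
        exact hyr
    have h2 := hA.convex hx h1 (sub_nonneg.2 ht1) ht0.le (sub_add_cancel 1 t)
    convert h2 using 1
    rw [smul_add, smul_smul, mul_inv_cancel₀ ht0.ne', one_smul, sub_smul, one_smul, smul_sub]
    abel
  refine ⟨t * r, by positivity, fun x hx => ⟨x + t • (z₀ - x), ?_, fun y hy hyr => ?_⟩⟩
  · exact hmem x hx _ (by simp) (by simp; positivity)
  · refine ⟨hmem x hx y hy hyr, ?_⟩
    have h3 : ‖z₀ - x‖ ≤ D := by
      rw [← dist_eq_norm, dist_comm]
      exact Metric.mem_closedBall.1 (hD hx)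
    calc dist y x = ‖(y - (x + t • (z₀ - x))) + t • (z₀ - x)‖ := by
          rw [dist_eq_norm]
          congr 1
          abel
      _ ≤ ‖y - (x + t • (z₀ - x))‖ + ‖t • (z₀ - x)‖ := norm_add_le _ _
      _ < t * r + t * D := by
          rw [norm_smul, Real.norm_of_nonneg ht0.le]
          exact add_lt_add_of_lt_of_le hyr (mul_le_mul_of_nonneg_left h3 ht0.le)
      _ ≤ δ := by linarith

/-- Norm equivalence for polynomials on a flat facet, uniformly over all pieces of the facet of
size `δ`: each such piece contains a hyperplane ball of fixed radius at whose centre the polynomial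
is comparable to its coefficients, chosen suitably. -/
theorem IsFlatFacet.exists_polyFun_norm_le (hA : IsFlatFacet S A ℓ a) (hS : IsCompact S) (p : ℕ)
    {δ : ℝ} (hδ : 0 < δ) : ∃ C r : ℝ, 0 < r ∧ ∀ x ∈ A, ∀ c : (Fin d → Fin (p + 1)) → ℝ,
      ∃ c' : (Fin d → Fin (p + 1)) → ℝ, (∀ y ∈ A, polyFun c' y = polyFun c y) ∧
        ∃ z, ‖c'‖ ≤ C * |polyFun c' z| ∧
          ∀ y, ℓ (y - z) = 0 → ‖y - z‖ < r → y ∈ A ∧ dist y x < δ := by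
  obtain ⟨r, hr, hrA⟩ := hA.exists_uniform_ball hS hδ
  obtain ⟨T, hTA, hT, hcov⟩ := Metric.finite_approx_of_totallyBounded
    (hS.totallyBounded.subset hA.subset) (r / 2) (by positivity)
  choose C hC using fun z => CurvedDG.exists_polyFun_norm_le p ℓ z (r := r / 4) (by positivity)
  refine ⟨∑ z ∈ hT.toFinset, |C z|, r / 4, by positivity, fun x hx c => ?_⟩
  obtain ⟨y₀, hy₀, hball⟩ := hrA x hx
  obtain ⟨z, hzT, hz⟩ := mem_iUnion₂.1 (hcov hy₀)
  obtain ⟨c', hc', w, hw0, hwr, hwc⟩ := hC z c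
  have hzA := hA.apply_eq (hTA hzT)
  refine ⟨c', fun y hy => hc' y (by rw [map_sub, hA.apply_eq hy, hzA, sub_self]), w, ?_, ?_⟩
  · refine hwc.trans (mul_le_mul_of_nonneg_right ?_ (abs_nonneg _))
    exact (le_abs_self _).trans (Finset.single_le_sum (f := fun z => |C z|)
      (fun i _ => abs_nonneg _) (hT.mem_toFinset.2 hzT))
  · intro y hy hyr
    refine hball y ?_ ?_
    · rw [map_sub, sub_eq_zero] at hy hw0 ⊢
      rw [hy, hw0, hzA, hA.apply_eq hy₀]
    · rw [Metric.mem_ball, dist_comm, dist_eq_norm] at hz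
      calc ‖y - y₀‖ = ‖(y - w) + (w - z) + (z - y₀)‖ := by congr 1; abel
        _ ≤ ‖y - w‖ + ‖w - z‖ + ‖z - y₀‖ := norm_add₃_le
        _ < r := by linarith

end FacetPolynomials

/-! ### Surface measure of flat and curved facets -/

section SurfaceMeasure

variable {d k : ℕ} {S A F : Set (E d)} {ℓ : E d →L[ℝ] ℝ} {a Λ h : ℝ} {f : E d → E d}

theorem euclideanHausdorffMeasure_image_le {n : ℕ} {K : NNReal} {T : Set (E d)}
    (hf : LipschitzOnWith K f T) :
    (Measure.euclideanHausdorffMeasure n : Measure (E d)) (f '' T) ≤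
      (K : ℝ≥0∞) ^ n * (Measure.euclideanHausdorffMeasure n : Measure (E d)) T := by
  rw [Measure.euclideanHausdorffMeasure_def, Measure.smul_apply, Measure.smul_apply,
    ENNReal.smul_def, ENNReal.smul_def, smul_eq_mul, smul_eq_mul, mul_left_comm]
  gcongr
  simpa using hf.hausdorffMeasure_image_le (Nat.cast_nonneg n)

theorem finrank_ker_eq (hℓ : ℓ ≠ 0) : Module.finrank ℝ (LinearMap.ker ℓ.toLinearMap) = d - 1 := by
  have h0 : ℓ.toLinearMap ≠ 0 := fun h => hℓ (by ext x; exact DFunLike.congr_fun h x)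
  have := Module.Dual.finrank_ker_add_one_of_ne_zero (K := ℝ) (V₁ := E d) h0
  rw [finrank_euclideanSpace_fin] at this
  exact Nat.eq_sub_of_add_eq this

/-- The open ball in the hyperplane through `z` parallel to the kernel of `ℓ`. -/
def planeBall (ℓ : E d →L[ℝ] ℝ) (z : E d) (r : ℝ) : Set (E d) :=
  {y | ℓ (y - z) = 0} ∩ {y | ‖y - z‖ < r}

theorem measurableSet_planeBall (z : E d) (r : ℝ) : MeasurableSet (planeBall ℓ z r) :=
  (isClosed_eq (by fun_prop) continuous_const).measurableSet.inter
    (isOpen_lt (by fun_prop) continuous_const).measurableSet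

/-- The surface measure of a ball in a hyperplane depends on its radius only, and it is positive and
finite because Hausdorff measure on the hyperplane is a Haar measure. -/
theorem exists_measure_planeBall_eq (hℓ : ℓ ≠ 0) {r : ℝ} (hr : 0 < r) :
    ∃ b : ℝ, 0 < b ∧ ∀ z, (Measure.euclideanHausdorffMeasure (d - 1) : Measure (E d))
      (planeBall ℓ z r) = ENNReal.ofReal b := by
  set H := LinearMap.ker ℓ.toLinearMap
  let μ : Measure H := Measure.euclideanHausdorffMeasure (Module.finrank ℝ H)
  refine ⟨(μ (Metric.ball 0 r)).toReal, ENNReal.toReal_pos (Metric.measure_ball_pos μ 0 hr).ne'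
    measure_ball_lt_top.ne, fun z => ?_⟩
  rw [ENNReal.ofReal_toReal measure_ball_lt_top.ne]
  have hiso : Isometry fun v : H => z + (v : E d) :=
    (IsometryEquiv.addLeft z).isometry.comp isometry_subtype_coe
  have himg : planeBall ℓ z r = (fun v : H => z + (v : E d)) '' Metric.ball 0 r := by
    ext y
    constructor
    · rintro ⟨h1, h2⟩
      exact ⟨⟨y - z, h1⟩, by rw [mem_ball_zero_iff]; exact h2, by simp⟩
    · rintro ⟨v, hv, rfl⟩
      rw [mem_ball_zero_iff] at hv
      refine ⟨?_, ?_⟩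
      · change ℓ (z + v - z) = 0
        rw [add_sub_cancel_left]
        exact v.2
      · change ‖z + (v : E d) - z‖ < r
        rw [add_sub_cancel_left]
        exact hv
  rw [himg, hiso.euclideanHausdorffMeasure_image, ← finrank_ker_eq hℓ]

theorem IsFlatFacet.measure_lt_top (hA : IsFlatFacet S A ℓ a) (hS : IsCompact S) :
    (Measure.euclideanHausdorffMeasure (d - 1) : Measure (E d)) A < ∞ := by
  rcases A.eq_empty_or_nonempty with h | ⟨z, hz⟩
  · simp [h]
  obtain ⟨D, hD⟩ := (hS.isBounded.subset hA.subset).subset_ball z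
  have hD0 : 0 < D := dist_nonneg.trans_lt (Metric.mem_ball.1 (hD hz))
  obtain ⟨b, -, hb⟩ := exists_measure_planeBall_eq hA.ne_zero hD0
  have hsub : A ⊆ planeBall ℓ z D := fun y hy =>
    ⟨by change ℓ (y - z) = 0; rw [map_sub, hA.apply_eq hy, hA.apply_eq hz, sub_self],
      mem_ball_iff_norm.1 (hD hy)⟩
  exact (measure_mono hsub).trans_lt (by rw [hb]; exact ENNReal.ofReal_lt_top)

theorem IsScaledMap.measure_image_le (hf : IsScaledMap S k Λ h f) (hA : A ⊆ S)
    (n : ℕ) : (Measure.euclideanHausdorffMeasure n : Measure (E d)) (f '' A) ≤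
      ENNReal.ofReal ((Λ * h) ^ n) * (Measure.euclideanHausdorffMeasure n : Measure (E d)) A := by
  rw [ENNReal.ofReal_pow (mul_nonneg hf.pos.le hf.scale_pos.le)]
  exact euclideanHausdorffMeasure_image_le (hf.lipschitzOnWith.mono hA)

theorem IsScaledMap.le_measure_image (hf : IsScaledMap S k Λ h f) (hA : A ⊆ S)
    (n : ℕ) : ENNReal.ofReal ((h / Λ) ^ n) *
      (Measure.euclideanHausdorffMeasure n : Measure (E d)) A ≤
        (Measure.euclideanHausdorffMeasure n : Measure (E d)) (f '' A) := by
  have h0 := hf.pos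
  have h1 := hf.scale_pos
  have himg : Function.invFunOn f S '' (f '' A) = A := by
    rw [image_image]
    exact (image_congr fun x hx => hf.inv_map (hA hx)).trans (image_id' A)
  have key := euclideanHausdorffMeasure_image_le (n := n)
    (hf.lipschitzOnWith_inv.mono (image_mono (f := f) hA))
  rw [himg] at key
  calc _ ≤ ENNReal.ofReal ((h / Λ) ^ n) * (ENNReal.ofReal (Λ / h) ^ n *
        (Measure.euclideanHausdorffMeasure n : Measure (E d)) (f '' A)) := by gcongr; exact key
    _ = _ := by
      rw [← mul_assoc, ← ENNReal.ofReal_pow (by positivity), ← ENNReal.ofReal_mul (by positivity),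
        ← mul_pow, div_mul_div_cancel₀ h0.ne', div_self h1.ne', one_pow, ENNReal.ofReal_one,
        one_mul]

end SurfaceMeasure

/-! ### The inverse estimate on one curved facet -/

section InverseEstimate

variable {d : ℕ} {S A : Set (E d)} {ℓ : E d →L[ℝ] ℝ} {a : ℝ}

/-- Pointwise bound of the iterated tangential derivatives of a mapped polynomial by its
coefficients. -/
theorem IsFlatFacet.exists_abs_iterTangentialDeriv_le (hA : IsFlatFacet S A ℓ a)
    (hS : UniqueDiffOn ℝ S) (hSc : IsCompact S) (k p : ℕ) (Λ : ℝ) :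
    ∃ C : ℝ, 0 ≤ C ∧ ∀ (h : ℝ) (f : E d → E d), IsScaledMap S k Λ h f →
      ∀ F ⊆ f '' A, (∀ y ∈ F, F ∈ 𝓝[f '' A] y) → ∀ c : (Fin d → Fin (p + 1)) → ℝ,
        ∀ α : List (Fin d), α.length ≤ k → ∀ y ∈ F,
          |iterTangentialDeriv F α (polyFun c ∘ Function.invFunOn f S) y| ≤
            C * h⁻¹ ^ α.length * ‖c‖ := by
  obtain ⟨C₁, hC₁, h₁⟩ :=
    exists_norm_iteratedFDerivWithin_iterRefDeriv_le hS (LinearMap.ker ℓ.toLinearMap) k Λ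
  obtain ⟨C₂, hC₂, h₂⟩ := exists_norm_iteratedFDerivWithin_polyFun_le hS hSc k p
  refine ⟨C₁ ^ k * C₂, by positivity, fun h f hf F hFA hF c α hα y hy => ?_⟩
  have hh := hf.scale_pos
  rw [hf.iterTangentialDeriv_eq hS hA hFA hF (contDiff_polyFun c).contDiffOn α hα y hy, abs_mul,
    abs_of_nonneg (by positivity)]
  have hyS : Function.invFunOn f S y ∈ S :=
    IsScaledMap.inv_mem (image_mono hA.subset (hFA hy))
  have h3 := h₁ h f hf (polyFun c) (C₂ * ‖c‖) (contDiff_polyFun c).contDiffOn (h₂ c) α 0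
    (by omega) _ hyS
  rw [norm_iteratedFDerivWithin_zero, Real.norm_eq_abs] at h3
  calc _ ≤ h⁻¹ ^ α.length * (C₁ ^ α.length * (C₂ * ‖c‖)) := by gcongr
    _ ≤ h⁻¹ ^ α.length * (C₁ ^ k * (C₂ * ‖c‖)) := by gcongr
    _ = _ := by ring

theorem sobolevSeminormSq_le_of_forall {F : Set (E d)} {r : ℕ} {g : E d → ℝ} {M : ℝ}
    (hM : ∀ α : List (Fin d), α.length = r → ∀ y ∈ F, |iterTangentialDeriv F α g y| ≤ M) :
    sobolevSeminormSq F r g ≤ ENNReal.ofReal (d ^ r * M ^ 2) *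
      (Measure.euclideanHausdorffMeasure (d - 1) : Measure (E d)) F := by
  have h1 : ∀ α : Fin r → Fin d,
      ∫⁻ x, ‖iterTangentialDeriv F (List.ofFn α) g x‖ₑ ^ 2 ∂(surfaceMeasure F) ≤
        ENNReal.ofReal (M ^ 2) *
          (Measure.euclideanHausdorffMeasure (d - 1) : Measure (E d)) F := by
    intro α
    rw [surfaceMeasure, ← setLIntegral_const]
    refine setLIntegral_mono measurable_const fun y hy => ?_
    have h2 := hM (List.ofFn α) (List.length_ofFn) y hy
    rw [ENNReal.ofReal_pow ((abs_nonneg _).trans h2), Real.enorm_eq_ofReal_abs]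
    gcongr
  refine (Finset.sum_le_sum fun α _ => h1 α).trans_eq ?_
  rw [Finset.sum_const, Finset.card_univ, Fintype.card_fun, Fintype.card_fin, Fintype.card_fin,
    nsmul_eq_mul, ENNReal.ofReal_mul (by positivity), ← Nat.cast_pow, ENNReal.ofReal_natCast,
    mul_assoc]

theorem lt_top_sobolevNorm {F : Set (E d)} {m : ℕ} {g : E d → ℝ}
    (h : ∀ r ≤ m, sobolevSeminormSq F r g < ⊤) : sobolevNorm F m g < ⊤ :=
  ENNReal.rpow_lt_top_of_nonneg (by norm_num)
    (ENNReal.sum_lt_top.2 fun r hr => h r (by rw [Finset.mem_range] at hr; omega)).ne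

/-- A mapped polynomial has finite Sobolev norms on a face. -/
theorem IsFlatFacet.sobolevNorm_lt_top (hA : IsFlatFacet S A ℓ a) (hS : UniqueDiffOn ℝ S)
    (hSc : IsCompact S) {k p : ℕ} {Λ h : ℝ} {f : E d → E d} (hf : IsScaledMap S k Λ h f)
    {F : Set (E d)} (hFA : F ⊆ f '' A) (hF : ∀ y ∈ F, F ∈ 𝓝[f '' A] y)
    (c : (Fin d → Fin (p + 1)) → ℝ) {m : ℕ} (hm : m ≤ k) :
    sobolevNorm F m (polyFun c ∘ Function.invFunOn f S) < ⊤ := by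
  obtain ⟨C, -, hC⟩ := hA.exists_abs_iterTangentialDeriv_le hS hSc k p Λ
  have hfin : (Measure.euclideanHausdorffMeasure (d - 1) : Measure (E d)) F < ∞ :=
    (measure_mono hFA).trans_lt ((hf.measure_image_le hA.subset _).trans_lt
      (ENNReal.mul_lt_top ENNReal.ofReal_lt_top (hA.measure_lt_top hSc)))
  refine lt_top_sobolevNorm fun r hr => ?_
  refine (sobolevSeminormSq_le_of_forall (M := C * h⁻¹ ^ r * ‖c‖) fun α hα y hy => ?_).trans_lt
    (ENNReal.mul_lt_top ENNReal.ofReal_lt_top hfin)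
  have := hC h f hf F hFA hF c α (by omega) y hy
  rwa [hα] at this

/-- The `L²` norm over a face that contains a piece of fixed size of the facet controls the
coefficients of a mapped polynomial, after a change that does not alter its values on the facet. -/
theorem IsFlatFacet.exists_le_lintegral (hA : IsFlatFacet S A ℓ a) (hS : UniqueDiffOn ℝ S)
    (hSc : IsCompact S) (hSv : Convex ℝ S) (k p : ℕ) (Λ : ℝ) {δ : ℝ} (hδ : 0 < δ) :
    ∃ B : ℝ, 0 < B ∧ ∀ x ∈ A, ∀ c : (Fin d → Fin (p + 1)) → ℝ,
      ∃ c' : (Fin d → Fin (p + 1)) → ℝ, (∀ y ∈ A, polyFun c' y = polyFun c y) ∧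
        ∀ (h : ℝ) (f : E d → E d), IsScaledMap S k Λ h f →
          ∀ F, f '' (A ∩ Metric.ball x δ) ⊆ F →
            ENNReal.ofReal (B * h ^ (d - 1) * ‖c'‖ ^ 2) ≤
              ∫⁻ y, ‖(polyFun c' ∘ Function.invFunOn f S) y‖ₑ ^ 2 ∂(surfaceMeasure F) := by
  obtain ⟨C₀, r, hr, hC₀⟩ := hA.exists_polyFun_norm_le hSc p hδ
  obtain ⟨L, hL0, hL⟩ := exists_norm_polyFun_sub_le hS hSc hSv p
  set C := max C₀ 1 with hCdef
  have hC : 0 < C := zero_lt_one.trans_le (le_max_right _ _)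
  -- on a ball of this radius the polynomial loses at most half of its value at the centre
  set η := min r (1 / (2 * C * (L + 1))) with hη
  have hη0 : 0 < η := lt_min hr (by positivity)
  obtain ⟨b, hb0, hb⟩ := exists_measure_planeBall_eq hA.ne_zero hη0
  refine ⟨(1 / (2 * C)) ^ 2 * (|Λ| + 1)⁻¹ ^ (d - 1) * b, by positivity, fun x hx c => ?_⟩
  obtain ⟨c', hc', z, hz, hball⟩ := hC₀ x hx c
  refine ⟨c', hc', fun h f hf F hF => ?_⟩
  have hh := hf.scale_pos
  have hΛ := hf.pos
  have hT : planeBall ℓ z η ⊆ A ∩ Metric.ball x δ := fun y hy =>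
    hball y hy.1 (lt_of_lt_of_le hy.2 (min_le_left _ _))
  have hTS : planeBall ℓ z η ⊆ S := fun y hy => hA.subset (hT hy).1
  have hzS : z ∈ S := hTS ⟨by change ℓ (z - z) = 0; simp, by change ‖z - z‖ < η; simpa using hη0⟩
  have hval : ∀ y ∈ planeBall ℓ z η, ‖c'‖ / (2 * C) ≤ |polyFun c' y| := by
    intro y hy
    have h1 : ‖c'‖ / C ≤ |polyFun c' z| := by
      rw [div_le_iff₀ hC, mul_comm]
      exact hz.trans (mul_le_mul_of_nonneg_right (le_max_left _ _) (abs_nonneg _))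
    have h2 : L * ‖c'‖ * ‖z - y‖ ≤ ‖c'‖ / (2 * C) := by
      have h3 : ‖z - y‖ ≤ 1 / (2 * C * (L + 1)) := by
        rw [norm_sub_rev]
        exact hy.2.le.trans (min_le_right _ _)
      calc L * ‖c'‖ * ‖z - y‖ ≤ (L + 1) * ‖c'‖ * (1 / (2 * C * (L + 1))) := by
            gcongr
            linarith
        _ = ‖c'‖ / (2 * C) := by field_simp
    have h4 := hL c' z hzS y (hTS hy)
    have h5 : |polyFun c' z| - |polyFun c' y| ≤ |polyFun c' z - polyFun c' y| :=
      abs_sub_abs_le_abs_sub _ _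
    have h6 : ‖c'‖ / C = ‖c'‖ / (2 * C) + ‖c'‖ / (2 * C) := by
      field_simp
      norm_num
    linarith
  have hmeas : MeasurableSet (f '' planeBall ℓ z η) :=
    (measurableSet_planeBall z η).image_of_continuousOn_injOn (hf.continuousOn.mono hTS)
      (hf.injOn.mono hTS)
  calc ENNReal.ofReal ((1 / (2 * C)) ^ 2 * (|Λ| + 1)⁻¹ ^ (d - 1) * b * h ^ (d - 1) * ‖c'‖ ^ 2)
      ≤ ENNReal.ofReal ((‖c'‖ / (2 * C)) ^ 2) *
        (ENNReal.ofReal ((h / Λ) ^ (d - 1)) * ENNReal.ofReal b) := by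
        rw [← ENNReal.ofReal_mul (by positivity), ← ENNReal.ofReal_mul (by positivity)]
        refine ENNReal.ofReal_le_ofReal ?_
        have h7 : (|Λ| + 1)⁻¹ ^ (d - 1) ≤ Λ⁻¹ ^ (d - 1) := by
          gcongr
          linarith [le_abs_self Λ]
        calc _ ≤ (1 / (2 * C)) ^ 2 * Λ⁻¹ ^ (d - 1) * b * h ^ (d - 1) * ‖c'‖ ^ 2 := by gcongr
          _ = _ := by rw [div_eq_mul_inv h Λ, mul_pow, div_pow, div_pow]; ring
    _ ≤ ENNReal.ofReal ((‖c'‖ / (2 * C)) ^ 2) *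
        (Measure.euclideanHausdorffMeasure (d - 1) : Measure (E d)) (f '' planeBall ℓ z η) := by
        gcongr
        rw [← hb z]
        exact hf.le_measure_image hTS (d - 1)
    _ ≤ ∫⁻ y in f '' planeBall ℓ z η, ‖(polyFun c' ∘ Function.invFunOn f S) y‖ₑ ^ 2
          ∂(Measure.euclideanHausdorffMeasure (d - 1)) := by
        rw [← setLIntegral_const]
        refine setLIntegral_mono' hmeas ?_
        rintro _ ⟨y, hy, rfl⟩
        rw [Function.comp_apply, hf.inv_map (hTS hy), Real.enorm_eq_ofReal_abs,
          ENNReal.ofReal_pow (by positivity)]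
        gcongr
        exact hval y hy
    _ ≤ _ := lintegral_mono_set ((image_mono hT).trans hF)

/-- Seminorm bounds of the right homogeneity in the element size `h` add up to a bound of the full
Sobolev norm, in which `h` may be replaced by a smaller size `η`. The bound `D` of the sizes absorbs
the seminorms of order less than `m`. -/
theorem sobolevNorm_le_of_forall {F : Set (E d)} {m k : ℕ} (hm : m ≤ k) {g : E d → ℝ}
    {C h η D : ℝ} (hC : 0 ≤ C) (hη : 0 < η) (hηh : η ≤ h) (hhD : h ≤ D) (hD : 1 ≤ D)
    (hr : ∀ r ≤ m, sobolevSeminormSq F r g ≤ ENNReal.ofReal (C * (h⁻¹ ^ r) ^ 2) *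
      ∫⁻ y, ‖g y‖ₑ ^ 2 ∂(surfaceMeasure F)) :
    sobolevNorm F m g ≤ ENNReal.ofReal (√((k + 1) * C) * D ^ k * η⁻¹ ^ m) *
      eLpNorm g 2 (surfaceMeasure F) := by
  have hh : 0 < h := hη.trans_le hηh
  have hsum : ∑ r ∈ Finset.range (m + 1), sobolevSeminormSq F r g ≤
      ENNReal.ofReal ((√((k + 1) * C) * D ^ k * η⁻¹ ^ m) ^ 2) *
        ∫⁻ y, ‖g y‖ₑ ^ 2 ∂(surfaceMeasure F) := by
    have h1 : ∀ r ∈ Finset.range (m + 1), sobolevSeminormSq F r g ≤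
        ENNReal.ofReal (C * (D ^ k * η⁻¹ ^ m) ^ 2) *
          ∫⁻ y, ‖g y‖ₑ ^ 2 ∂(surfaceMeasure F) := by
      intro r hrm
      rw [Finset.mem_range] at hrm
      refine (hr r (by omega)).trans ?_
      gcongr
      calc h⁻¹ ^ r = h ^ (m - r) * h⁻¹ ^ m := by
            rw [← Nat.sub_add_cancel (by omega : r ≤ m), pow_add, Nat.add_sub_cancel, ← mul_assoc,
              ← mul_pow, mul_inv_cancel₀ hh.ne', one_pow, one_mul]
        _ ≤ D ^ (m - r) * η⁻¹ ^ m := by gcongr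
        _ ≤ D ^ k * η⁻¹ ^ m := by
            gcongr
            omega
    refine (Finset.sum_le_sum h1).trans ?_
    rw [Finset.sum_const, Finset.card_range, nsmul_eq_mul, ← mul_assoc]
    gcongr
    rw [← ENNReal.ofReal_natCast, ← ENNReal.ofReal_mul (by positivity)]
    refine ENNReal.ofReal_le_ofReal ?_
    rw [mul_assoc (√_), mul_pow (√_), Real.sq_sqrt (by positivity), ← mul_assoc]
    gcongr
    push_cast
    have : (m : ℝ) ≤ k := by exact_mod_cast hm
    linarith
  have hL2 : eLpNorm g 2 (surfaceMeasure F) =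
      (∫⁻ y, ‖g y‖ₑ ^ 2 ∂(surfaceMeasure F)) ^ (1 / 2 : ℝ) := by
    rw [eLpNorm_eq_lintegral_rpow_enorm_toReal (by norm_num) (by norm_num)]
    simp
  rw [hL2, sobolevNorm]
  refine (ENNReal.rpow_le_rpow hsum (by norm_num)).trans_eq ?_
  have hD0 : 0 < D := zero_lt_one.trans_le hD
  rw [ENNReal.mul_rpow_of_nonneg _ _ (by norm_num), ENNReal.ofReal_rpow_of_nonneg (by positivity)
    (by norm_num), ← Real.sqrt_eq_rpow, Real.sqrt_sq (by positivity)]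

/-- The trace inverse estimate for the maps of one reference facet. -/
theorem IsFlatFacet.exists_sobolevNorm_le (hA : IsFlatFacet S A ℓ a) (hS : UniqueDiffOn ℝ S)
    (hSc : IsCompact S) (hSv : Convex ℝ S) (k p : ℕ) (Λ D : ℝ) {δ : ℝ} (hδ : 0 < δ) :
    ∃ C : ℝ, ∀ x ∈ A, ∀ c : (Fin d → Fin (p + 1)) → ℝ,
      ∃ c' : (Fin d → Fin (p + 1)) → ℝ, (∀ y ∈ A, polyFun c' y = polyFun c y) ∧
        ∀ (h : ℝ) (f : E d → E d), IsScaledMap S k Λ h f → h ≤ D →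
          ∀ F ⊆ f '' A, (∀ y ∈ F, F ∈ 𝓝[f '' A] y) → f '' (A ∩ Metric.ball x δ) ⊆ F →
            ∀ η, 0 < η → η ≤ h → ∀ m ≤ k,
              sobolevNorm F m (polyFun c' ∘ Function.invFunOn f S) ≤
                ENNReal.ofReal (C * η⁻¹ ^ m) *
                  eLpNorm (polyFun c' ∘ Function.invFunOn f S) 2 (surfaceMeasure F) := by
  obtain ⟨C₁, hC₁0, hC₁⟩ := hA.exists_abs_iterTangentialDeriv_le hS hSc k p Λ
  obtain ⟨B, hB0, hB⟩ := hA.exists_le_lintegral hS hSc hSv k p Λ hδ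
  set μA := (Measure.euclideanHausdorffMeasure (d - 1) : Measure (E d)) A with hμA
  have hμA_top : μA ≠ ∞ := (hA.measure_lt_top hSc).ne
  set C₂ : ℝ := (d + 1 : ℝ) ^ k * C₁ ^ 2 * |Λ| ^ (d - 1) * μA.toReal / B with hC₂
  refine ⟨√((k + 1) * C₂) * max D 1 ^ k, fun x hx c => ?_⟩
  obtain ⟨c', hc', hint⟩ := hB x hx c
  refine ⟨c', hc', fun h f hf hhD F hFA hF hxF η hη hηh m hm => ?_⟩
  have hh := hf.scale_pos
  have hΛ := hf.pos
  refine sobolevNorm_le_of_forall hm (by positivity) hη hηh (hhD.trans (le_max_left _ _))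
    (le_max_right _ _) fun r hr => ?_
  have hμF : (Measure.euclideanHausdorffMeasure (d - 1) : Measure (E d)) F ≤
      ENNReal.ofReal ((Λ * h) ^ (d - 1) * μA.toReal) := by
    refine (measure_mono hFA).trans ((hf.measure_image_le hA.subset _).trans_eq ?_)
    rw [ENNReal.ofReal_mul (by positivity), ENNReal.ofReal_toReal hμA_top]
  calc sobolevSeminormSq F r (polyFun c' ∘ Function.invFunOn f S)
      ≤ ENNReal.ofReal (d ^ r * (C₁ * h⁻¹ ^ r * ‖c'‖) ^ 2) *
        (Measure.euclideanHausdorffMeasure (d - 1) : Measure (E d)) F := by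
        refine sobolevSeminormSq_le_of_forall fun α hα y hy => ?_
        have := hC₁ h f hf F hFA hF c' α (by omega) y hy
        rwa [hα] at this
    _ ≤ ENNReal.ofReal (d ^ r * (C₁ * h⁻¹ ^ r * ‖c'‖) ^ 2) *
        ENNReal.ofReal ((Λ * h) ^ (d - 1) * μA.toReal) := by gcongr
    _ ≤ ENNReal.ofReal (C₂ * (h⁻¹ ^ r) ^ 2) * ENNReal.ofReal (B * h ^ (d - 1) * ‖c'‖ ^ 2) := by
        rw [← ENNReal.ofReal_mul (by positivity), ← ENNReal.ofReal_mul (by positivity)]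
        refine ENNReal.ofReal_le_ofReal ?_
        have hdr : (d : ℝ) ^ r ≤ (d + 1 : ℝ) ^ k :=
          (pow_le_pow_left₀ (by positivity) (by linarith) r).trans
            (pow_le_pow_right₀ (by linarith [Nat.cast_nonneg (α := ℝ) d]) (by omega))
        calc (d : ℝ) ^ r * (C₁ * h⁻¹ ^ r * ‖c'‖) ^ 2 * ((Λ * h) ^ (d - 1) * μA.toReal)
            ≤ (d + 1 : ℝ) ^ k * (C₁ * h⁻¹ ^ r * ‖c'‖) ^ 2 *
              ((Λ * h) ^ (d - 1) * μA.toReal) := by gcongr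
          _ = C₂ * (h⁻¹ ^ r) ^ 2 * (B * h ^ (d - 1) * ‖c'‖ ^ 2) := by
              rw [hC₂, abs_of_pos hΛ, mul_pow Λ h]
              field_simp
    _ ≤ _ := by
        gcongr
        exact hint h f hf F hxF

end InverseEstimate

/-! ### Traces of functions that are continuous up to the boundary -/

/-- If `v` agrees almost everywhere on `K` with a function `u` that tends to `b` at `x`, then `b` is
the value of the trace of `v` at `x`. -/
theorem tendsto_average_abs_sub {d : ℕ} {K : Set (E d)} (hK : MeasurableSet K) {u v : E d → ℝ}
    {x : E d} {b : ℝ} (huv : v =ᵐ[volume.restrict K] u) (hu : Tendsto u (𝓝[K] x) (𝓝 b)) :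
    Tendsto (fun r : ℝ => ⨍ y in K ∩ Metric.ball x r, |v y - b|) (𝓝[>] 0) (𝓝 0) := by
  rw [Metric.tendsto_nhds]
  intro ε hε
  obtain ⟨r₀, hr₀, hr⟩ := Metric.tendsto_nhdsWithin_nhds.1 hu (ε / 2) (by positivity)
  filter_upwards [Ioo_mem_nhdsGT hr₀] with r hrr
  set T := K ∩ Metric.ball x r with hT
  have hTfin : volume T < ∞ :=
    (measure_mono inter_subset_right).trans_lt measure_ball_lt_top
  have hbound : ∀ᵐ y ∂volume.restrict T, ‖|v y - b|‖ ≤ ε / 2 := by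
    have h1 : ∀ᵐ y ∂volume.restrict T, v y = u y :=
      ae_mono (Measure.restrict_mono inter_subset_left le_rfl) huv
    filter_upwards [h1, ae_restrict_mem (hK.inter measurableSet_ball)] with y hy hyT
    rw [hy, Real.norm_eq_abs, abs_abs, ← Real.dist_eq]
    exact (hr hyT.1 ((Metric.mem_ball.1 hyT.2).trans hrr.2)).le
  have hint : ‖∫ y in T, |v y - b|‖ ≤ ε / 2 * volume.real T :=
    norm_setIntegral_le_of_norm_le_const_ae hTfin hbound
  rw [dist_zero_right, setAverage_eq, norm_smul, norm_inv, Real.norm_of_nonneg measureReal_nonneg]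
  refine lt_of_le_of_lt ?_ (half_lt_self hε)
  rcases (measureReal_nonneg (μ := volume) (s := T)).eq_or_lt with h0 | h0
  · -- the average over a null set is zero
    rw [← h0, inv_zero, zero_mul]
    positivity
  · rw [inv_mul_le_iff₀ h0, mul_comm]
    exact hint

/-! ### Shape-regular elements are rescaled reference elements -/

namespace RefShape

theorem exists_ball_subset (s : RefShape) (d : ℕ) :
    ∃ r > 0, Metric.ball (s.center d) r ⊆ s.interior d :=
  Metric.isOpen_iff.1 s.isOpen_interior _ s.center_mem

end RefShape

namespace CurvedElement

variable {d : ℕ} (K : CurvedElement d)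

theorem isBounded_straight : Bornology.IsBounded K.straight :=
  K.B.lipschitz.isBounded_image K.shape.isBounded_interior

theorem size_nonneg : 0 ≤ K.size := Metric.diam_nonneg

/-- A ball inscribed in the reference element bounds `B` by the size of the element. -/
theorem norm_B_apply_le {r : ℝ} (hr : 0 < r)
    (hball : Metric.ball (K.shape.center d) r ⊆ K.shape.interior d) (v : E d) :
    ‖K.B v‖ ≤ 2 / r * K.size * ‖v‖ := by
  rcases eq_or_ne v 0 with rfl | hv
  · simp
  have hv0 : 0 < ‖v‖ := norm_pos_iff.2 hv
  set t : ℝ := r / (2 * ‖v‖) with ht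
  have ht0 : 0 < t := by positivity
  have h1 : K.shape.center d + t • v ∈ K.shape.interior d := by
    refine hball ?_
    rw [mem_ball_iff_norm, add_sub_cancel_left, norm_smul, Real.norm_of_nonneg ht0.le, ht]
    field_simp
    linarith
  have h2 := Metric.dist_le_diam_of_mem K.isBounded_straight (mem_image_of_mem K.B h1)
    (mem_image_of_mem K.B K.shape.center_mem)
  rw [dist_eq_norm, ← map_sub, add_sub_cancel_left, map_smul, norm_smul,
    Real.norm_of_nonneg ht0.le, ht] at h2
  change _ ≤ K.size at h2
  rw [div_mul_eq_mul_div, div_le_iff₀ (by positivity)] at h2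
  rw [div_mul_eq_mul_div, div_mul_eq_mul_div, le_div_iff₀ hr]
  linarith

theorem size_pos (hd : 1 ≤ d) : 0 < K.size := by
  obtain ⟨r, hr, hball⟩ := K.shape.exists_ball_subset d
  have h1 := K.norm_B_apply_le hr hball (EuclideanSpace.single (⟨0, hd⟩ : Fin d) (1 : ℝ))
  refine K.size_nonneg.lt_of_ne fun h0 => ?_
  rw [← h0, mul_zero, zero_mul] at h1
  have h2 := (map_eq_zero_iff K.B K.B.injective).1 (norm_le_zero_iff.1 h1)
  simp at h2

/-- A ball inscribed in the straight element bounds the inverse of `B`. -/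
theorem size_mul_norm_le (hd : 1 ≤ d) {σ : ℝ} (hσ : 0 < σ) {x : E d}
    (hball : Metric.ball x (σ * K.size) ⊆ K.straight) (v : E d) :
    K.size * ‖v‖ ≤ 2 * Metric.diam (K.shape.interior d) / σ * ‖K.B v‖ := by
  rcases eq_or_ne v 0 with rfl | hv
  · simp
  have hBv : 0 < ‖K.B v‖ := norm_pos_iff.2 fun h => hv ((map_eq_zero_iff K.B K.B.injective).1 h)
  have hh := K.size_pos hd
  set t : ℝ := σ * K.size / (2 * ‖K.B v‖) with ht
  have ht0 : 0 < t := by positivity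
  obtain ⟨y, hy, hyx⟩ : x ∈ K.straight := hball (Metric.mem_ball_self (by positivity))
  obtain ⟨z, hz, hzx⟩ : x + t • K.B v ∈ K.straight := by
    refine hball ?_
    rw [mem_ball_iff_norm, add_sub_cancel_left, norm_smul, Real.norm_of_nonneg ht0.le, ht]
    field_simp
    nlinarith [mul_pos hσ hh]
  have hzy : z - y = t • v := by
    apply K.B.injective
    rw [map_sub, map_smul, hyx, hzx, add_sub_cancel_left]
  have h2 := Metric.dist_le_diam_of_mem K.shape.isBounded_interior hz hy
  rw [dist_eq_norm, hzy, norm_smul, Real.norm_of_nonneg ht0.le, ht, div_mul_eq_mul_div,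
    div_le_iff₀ (by positivity)] at h2
  rw [div_mul_eq_mul_div, le_div_iff₀ hσ]
  linarith

theorem uniqueDiffOn_refClosed : UniqueDiffOn ℝ K.refClosed := K.shape.uniqueDiffOn_closed

theorem convex_refClosed : Convex ℝ K.refClosed := K.shape.convex_closed

theorem isCompact_refClosed : IsCompact K.refClosed := K.shape.isCompact_closed

theorem contDiffOn_one_map : ContDiffOn ℝ 1 K.map K.refClosed :=
  (K.B.contDiff.contDiffOn.add contDiffOn_const).add K.contDiffOn_Φ

theorem hasFDerivWithinAt_Φ {x : E d} (hx : x ∈ K.refClosed) :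
    HasFDerivWithinAt K.Φ (fderivWithin ℝ K.Φ K.refClosed x) K.refClosed x :=
  (K.contDiffOn_Φ.differentiableOn one_ne_zero x hx).hasFDerivWithinAt

theorem fderivWithin_map {x : E d} (hx : x ∈ K.refClosed) :
    fderivWithin ℝ K.map K.refClosed x =
      (K.B : E d →L[ℝ] E d) + fderivWithin ℝ K.Φ K.refClosed x :=
  ((K.B.hasFDerivAt.hasFDerivWithinAt.add_const K.b).add
    (K.hasFDerivWithinAt_Φ hx)).fderivWithin (K.uniqueDiffOn_refClosed x hx)

variable {K} {c : ℝ}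

theorem norm_fderivWithin_Φ_apply_le (hc0 : 0 ≤ c) (hc : K.distortion ≤ ENNReal.ofReal c)
    {x : E d} (hx : x ∈ K.refClosed) (v : E d) :
    ‖fderivWithin ℝ K.Φ K.refClosed x v‖ ≤ c * ‖K.B v‖ := by
  have h1 : ‖(fderivWithin ℝ K.Φ K.refClosed x).comp (K.B.symm : E d →L[ℝ] E d)‖ ≤ c := by
    rw [← ENNReal.ofReal_le_ofReal_iff hc0]
    exact (le_iSup₂ (f := fun x (_ : x ∈ K.shape.closed d) => ENNReal.ofReal
      ‖(fderivWithin ℝ K.Φ (K.shape.closed d) x).comp (K.B.symm : E d →L[ℝ] E d)‖) x hx).trans hc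
  have h2 := ContinuousLinearMap.le_of_opNorm_le _ h1 (K.B v)
  simpa using h2

theorem norm_Φ_sub_le (hc0 : 0 ≤ c) (hc : K.distortion ≤ ENNReal.ofReal c) {x y : E d}
    (hx : x ∈ K.refClosed) (hy : y ∈ K.refClosed) : ‖K.Φ x - K.Φ y‖ ≤ c * ‖K.B (x - y)‖ := by
  -- the mean value inequality for `Φ ∘ B⁻¹` on the straight element
  have hconv : Convex ℝ (K.B '' K.refClosed) :=
    K.convex_refClosed.linear_image (K.B : E d →L[ℝ] E d).toLinearMap
  have hderiv : ∀ z ∈ K.B '' K.refClosed, HasFDerivWithinAt (K.Φ ∘ K.B.symm)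
      ((fderivWithin ℝ K.Φ K.refClosed (K.B.symm z)).comp (K.B.symm : E d →L[ℝ] E d))
      (K.B '' K.refClosed) z := by
    rintro _ ⟨w, hw, rfl⟩
    refine HasFDerivWithinAt.comp (t := K.refClosed) _ ?_
      K.B.symm.hasFDerivAt.hasFDerivWithinAt ?_
    · rw [K.B.symm_apply_apply]
      exact K.hasFDerivWithinAt_Φ hw
    · rintro _ ⟨w', hw', rfl⟩
      rwa [K.B.symm_apply_apply]
  have hle : ∀ z ∈ K.B '' K.refClosed,
      ‖(fderivWithin ℝ K.Φ K.refClosed (K.B.symm z)).comp (K.B.symm : E d →L[ℝ] E d)‖ ≤ c := by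
    rintro _ ⟨w, hw, rfl⟩
    refine ContinuousLinearMap.opNorm_le_bound _ hc0 fun v => ?_
    rw [K.B.symm_apply_apply]
    have := norm_fderivWithin_Φ_apply_le hc0 hc hw (K.B.symm v)
    rwa [K.B.apply_symm_apply] at this
  have := hconv.norm_image_sub_le_of_norm_hasFDerivWithin_le hderiv hle
    (mem_image_of_mem K.B hy) (mem_image_of_mem K.B hx)
  rwa [Function.comp_apply, Function.comp_apply, K.B.symm_apply_apply, K.B.symm_apply_apply,
    ← map_sub] at this

theorem map_sub_map (x y : E d) : K.map x - K.map y = K.B (x - y) + (K.Φ x - K.Φ y) := by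
  simp only [map, map_sub]
  abel

theorem norm_map_sub_le (hc0 : 0 ≤ c) (hc : K.distortion ≤ ENNReal.ofReal c) {x y : E d}
    (hx : x ∈ K.refClosed) (hy : y ∈ K.refClosed) :
    ‖K.map x - K.map y‖ ≤ (1 + c) * ‖K.B (x - y)‖ := by
  rw [map_sub_map]
  have h1 := norm_add_le (K.B (x - y)) (K.Φ x - K.Φ y)
  have h2 := norm_Φ_sub_le hc0 hc hx hy
  linarith

theorem le_norm_map_sub (hc0 : 0 ≤ c) (hc : K.distortion ≤ ENNReal.ofReal c) {x y : E d}
    (hx : x ∈ K.refClosed) (hy : y ∈ K.refClosed) :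
    (1 - c) * ‖K.B (x - y)‖ ≤ ‖K.map x - K.map y‖ := by
  rw [map_sub_map]
  have h1 := norm_sub_le_norm_add (K.B (x - y)) (K.Φ x - K.Φ y)
  have h2 := norm_Φ_sub_le hc0 hc hx hy
  linarith

/-- An element with small distortion is not larger than its curved image. -/
theorem size_le (hc0 : 0 ≤ c) (hc1 : c < 1) (hc : K.distortion ≤ ENNReal.ofReal c)
    {Z : Set (E d)} (hZ : Bornology.IsBounded Z) (hKZ : K.carrier ⊆ Z) :
    K.size ≤ Metric.diam Z / (1 - c) := by
  have h1c : 0 < 1 - c := by linarith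
  refine Metric.diam_le_of_forall_dist_le (by have := Metric.diam_nonneg (s := Z); positivity) ?_
  rintro _ ⟨x, hx, rfl⟩ _ ⟨y, hy, rfl⟩
  rw [dist_eq_norm, ← map_sub, le_div_iff₀ h1c, mul_comm]
  refine (le_norm_map_sub hc0 hc (K.shape.interior_subset_closed hx)
    (K.shape.interior_subset_closed hy)).trans ?_
  rw [← dist_eq_norm]
  exact Metric.dist_le_diam_of_mem hZ (hKZ (mem_image_of_mem _ hx)) (hKZ (mem_image_of_mem _ hy))

theorem isBounded_carrier (K : CurvedElement d) : Bornology.IsBounded K.carrier :=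
  (K.isCompact_refClosed.image_of_continuousOn K.contDiffOn_one_map.continuousOn).isBounded.subset
    (image_mono K.shape.interior_subset_closed)

/-- The maps of shape-regular elements of bounded size are dilations by the element size, up to a
uniform constant. -/
theorem exists_isScaledMap (hd : 1 ≤ d) {σ : ℝ} (hσ : 0 < σ) (hc0 : 0 ≤ c) (hc1 : c < 1) (k : ℕ)
    (D : ℝ) (M : ℕ → ℝ) (s : RefShape) :
    ∃ Λ : ℝ, ∀ K : CurvedElement d, K.shape = s →
      (∃ x, Metric.ball x (σ * K.size) ⊆ K.straight) → K.distortion ≤ ENNReal.ofReal c →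
      K.size ≤ D → ContDiffOn ℝ k K.map K.refClosed →
      (∀ l, 2 ≤ l → l ≤ k → ∀ x ∈ K.refClosed,
        ‖iteratedFDerivWithin ℝ l K.map K.refClosed x‖ ≤
          M l * ‖(K.B : E d →L[ℝ] E d)‖ ^ l) →
      IsScaledMap K.refClosed k Λ K.size K.map := by
  obtain ⟨r, hr, hball⟩ := s.exists_ball_subset d
  have h1c : 0 < 1 - c := by linarith
  set Λ₁ : ℝ := 2 / r with hΛ₁
  have hΛ₁0 : 0 < Λ₁ := by positivity
  set Λ₂ : ℝ := 2 * Metric.diam (s.interior d) / σ / (1 - c) with hΛ₂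
  have hΛ₂0 : 0 ≤ Λ₂ := by
    have := Metric.diam_nonneg (s := s.interior d)
    positivity
  set Λ₃ : ℝ := ∑ l ∈ Finset.range (k + 1), |M l| * (Λ₁ * max D 1) ^ l with hΛ₃
  have hΛ₃0 : 0 ≤ Λ₃ := by
    have : 0 < max D 1 := zero_lt_one.trans_le (le_max_right _ _)
    positivity
  refine ⟨1 + 2 * Λ₁ + Λ₂ + Λ₃, ?_⟩
  rintro K hKs ⟨x₀, hx₀⟩ hdist hD hck hM
  have hh := K.size_pos hd
  have hup : ∀ v, ‖K.B v‖ ≤ Λ₁ * K.size * ‖v‖ := K.norm_B_apply_le hr (by rwa [hKs])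
  have hlow : ∀ v, K.size * ‖v‖ ≤ Λ₂ * ((1 - c) * ‖K.B v‖) := fun v => by
    have h1 := K.size_mul_norm_le hd hσ hx₀ v
    rw [hKs] at h1
    rwa [hΛ₂, ← mul_assoc, div_mul_cancel₀ _ h1c.ne']
  have hΛ₁Λ : 2 * Λ₁ ≤ 1 + 2 * Λ₁ + Λ₂ + Λ₃ := by linarith
  have hΛ₂Λ : Λ₂ ≤ 1 + 2 * Λ₁ + Λ₂ + Λ₃ := by linarith
  have hup' : ∀ v, (1 + c) * ‖K.B v‖ ≤ (1 + 2 * Λ₁ + Λ₂ + Λ₃) * K.size * ‖v‖ := fun v => by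
    calc (1 + c) * ‖K.B v‖ ≤ 2 * (Λ₁ * K.size * ‖v‖) := by
          have := hup v
          gcongr
          linarith
      _ = 2 * Λ₁ * K.size * ‖v‖ := by ring
      _ ≤ _ := by gcongr
  refine ⟨by positivity, hh, K.contDiffOn_one_map, hck, fun x hx y hy => ?_, fun x hx y hy => ?_,
    fun x hx => ?_, fun x hx v => ?_, fun l h2l hlk x hx => ?_⟩
  · exact (norm_map_sub_le hc0 hdist hx hy).trans (hup' _)
  · exact (hlow _).trans (mul_le_mul hΛ₂Λ (le_norm_map_sub hc0 hdist hx hy) (by positivity)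
      (by positivity))
  · refine ContinuousLinearMap.opNorm_le_bound _ (by positivity) fun v => ?_
    rw [K.fderivWithin_map hx]
    refine le_trans ?_ (hup' v)
    have h1 := norm_add_le (K.B v) (fderivWithin ℝ K.Φ K.refClosed x v)
    have h2 := norm_fderivWithin_Φ_apply_le hc0 hdist hx v
    change ‖K.B v + fderivWithin ℝ K.Φ K.refClosed x v‖ ≤ _
    linarith
  · rw [K.fderivWithin_map hx]
    refine (hlow v).trans (mul_le_mul hΛ₂Λ ?_ (by positivity) (by positivity))
    have h1 := norm_sub_le_norm_add (K.B v) (fderivWithin ℝ K.Φ K.refClosed x v)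
    have h2 := norm_fderivWithin_Φ_apply_le hc0 hdist hx v
    change _ ≤ ‖K.B v + fderivWithin ℝ K.Φ K.refClosed x v‖
    linarith
  · have hB : ‖(K.B : E d →L[ℝ] E d)‖ ≤ Λ₁ * K.size :=
      ContinuousLinearMap.opNorm_le_bound _ (by positivity) hup
    have hmax : 1 ≤ max D 1 := le_max_right _ _
    calc ‖iteratedFDerivWithin ℝ l K.map K.refClosed x‖
        ≤ |M l| * (Λ₁ * K.size) ^ l := (hM l h2l hlk x hx).trans (by
          gcongr
          exact le_abs_self _)
      _ ≤ |M l| * (Λ₁ * max D 1) ^ l * K.size := by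
          obtain ⟨n, rfl⟩ : ∃ n, l = n + 1 := ⟨l - 1, by omega⟩
          rw [mul_assoc, mul_pow, mul_pow, mul_assoc, pow_succ K.size]
          gcongr
          calc K.size ^ n ≤ max D 1 ^ n := by
                gcongr
                exact hD.trans (le_max_left _ _)
            _ ≤ max D 1 ^ (n + 1) := pow_le_pow_right₀ hmax (by omega)
      _ ≤ Λ₃ * K.size := by
          gcongr
          exact Finset.single_le_sum (f := fun l => |M l| * (Λ₁ * max D 1) ^ l)
            (fun i _ => by positivity) (Finset.mem_range.2 (by omega))
      _ ≤ _ := by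
          gcongr
          linarith

end CurvedElement

/-! ### Faces of a mesh -/

namespace Mesh

variable {d : ℕ} {Ω : Set (E d)} (T : Mesh d Ω)

/-- A face of `K` is a relatively open part of one curved facet of `K`. -/
theorem IsFaceOf.exists_facet {T : Mesh d Ω} {K : T.Elem} {F : Set (E d)} (h : T.IsFaceOf K F) :
    ∃ A ∈ (T.elem K).shape.facets d, F ⊆ (T.elem K).map '' A ∧
      ∀ y ∈ F, F ∈ 𝓝[(T.elem K).map '' A] y := by
  -- where two germs of sets agree at a point, they agree at all nearby points
  have key : ∀ (s t : Set (E d)) (y : E d), 𝓝[s] y = 𝓝[t] y →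
      {x | x ∈ s ∧ x ∈ t ∧ 𝓝[s] x = 𝓝[t] x} ∈ 𝓝[s] y := by
    intro s t y hst
    have h1 : ∀ᶠ x in 𝓝[s] y, 𝓝[s] x = 𝓝[t] x := by
      refine Filter.Eventually.filter_mono nhdsWithin_le_nhds ?_
      filter_upwards [(nhdsWithin_eq_iff_eventuallyEq.1 hst).eventuallyEq_nhds] with x hx
      exact nhdsWithin_eq_iff_eventuallyEq.2 hx
    have h2 : t ∈ 𝓝[s] y := hst ▸ self_mem_nhdsWithin
    filter_upwards [h1, h2, self_mem_nhdsWithin] with x hx1 hx2 hx3 using ⟨hx3, hx2, hx1⟩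
  rcases h with ⟨K', ⟨-, -, A, hA, A', -, rfl⟩ | ⟨-, -, A', -, A, hA, rfl⟩⟩ | ⟨-, A, hA, rfl⟩
  · exact ⟨A, hA, fun x hx => hx.1, fun y hy => key _ _ y hy.2.2⟩
  · refine ⟨A, hA, fun x hx => hx.2.1, fun y hy => ?_⟩
    filter_upwards [key _ _ y hy.2.2.symm] with x hx using ⟨hx.2.1, hx.1, hx.2.2.symm⟩
  · refine ⟨A, hA, fun x hx => hx.1, fun y hy => ?_⟩
    filter_upwards [self_mem_nhdsWithin, eventually_eventually_nhdsWithin.2 hy.2] with x hx1 hx2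
      using ⟨hx1, hx2⟩

theorem faceSize_le {K : T.Elem} {F : Set (E d)} (h : T.IsFaceOf K F) :
    T.faceSize F ≤ (T.elem K).size :=
  csInf_le ⟨0, by rintro _ ⟨K', -, rfl⟩; exact (T.elem K').size_nonneg⟩ ⟨K, h, rfl⟩

theorem faceSize_pos (hd : 1 ≤ d) {K : T.Elem} {F : Set (E d)} (h : T.IsFaceOf K F) :
    0 < T.faceSize F := by
  have := T.finite
  have hne : ((fun K => (T.elem K).size) '' {K | T.IsFaceOf K F}).Nonempty := ⟨_, K, h, rfl⟩
  obtain ⟨K', -, hK'⟩ := hne.csInf_mem (Set.toFinite _)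
  rw [faceSize, ← hK']
  exact (T.elem K').size_pos hd

theorem carrier_subset (K : T.Elem) : (T.elem K).carrier ⊆ closure Ω :=
  T.cover ▸ subset_closure.trans (subset_iUnion (fun K => closure (T.elem K).carrier) K)

/-- A domain with a finite mesh is bounded. -/
theorem isBounded_closure (T : Mesh d Ω) : Bornology.IsBounded (closure Ω) := by
  have := T.finite
  rw [← T.cover]
  exact Bornology.isBounded_iUnion.2 fun K => (T.elem K).isBounded_carrier.closure

end Mesh

/-! ### Traces of mapped polynomials -/

namespace IsScaledMap

variable {d k p : ℕ} {Λ h : ℝ} {K : CurvedElement d}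

/-- A mapped polynomial is a trace of its values on the element. On the face it may be replaced by
one that agrees with it on the facet only. -/
theorem isTrace (hf : IsScaledMap K.refClosed k Λ h K.map) {A F : Set (E d)}
    (hA : A ⊆ K.refClosed) (hAm : MeasurableSet A) (hFA : F ⊆ K.map '' A) {v : E d → ℝ}
    {c c' : (Fin d → Fin (p + 1)) → ℝ}
    (hv : v =ᵐ[volume.restrict K.carrier] fun x => polyFun c (K.invMap x))
    (hc : ∀ y ∈ A, polyFun c' y = polyFun c y) :
    IsTrace K.carrier F v (polyFun c' ∘ Function.invFunOn K.map K.refClosed) := by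
  have hsub : K.shape.interior d ⊆ K.refClosed := K.shape.interior_subset_closed
  have hKm : MeasurableSet K.carrier :=
    K.shape.isOpen_interior.measurableSet.image_of_continuousOn_injOn (hf.continuousOn.mono hsub)
      (hf.injOn.mono hsub)
  have hinv : ∀ y ∈ K.carrier, K.invMap y = Function.invFunOn K.map K.refClosed y := by
    rintro _ ⟨x, hx, rfl⟩
    have h1 : K.invMap (K.map x) ∈ K.shape.interior d :=
      Function.invFunOn_mem (mem_image_of_mem _ hx)
    have h2 : K.map (K.invMap (K.map x)) = K.map x :=
      Function.invFunOn_eq (mem_image_of_mem _ hx)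
    rw [hf.inv_map (hsub hx)]
    exact hf.injOn (hsub h1) (hsub hx) h2
  have hv' : v =ᵐ[volume.restrict K.carrier]
      polyFun c ∘ Function.invFunOn K.map K.refClosed := by
    filter_upwards [hv, ae_restrict_mem hKm] with y hy hyK
    rw [hy, hinv y hyK]
    rfl
  have hAm' : MeasurableSet (K.map '' A) :=
    hAm.image_of_continuousOn_injOn (hf.continuousOn.mono hA) (hf.injOn.mono hA)
  refine ae_mono (Measure.restrict_mono hFA le_rfl)
    (ae_restrict_of_forall_mem hAm' ?_)
  rintro _ ⟨x, hx, rfl⟩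
  refine tendsto_average_abs_sub hKm hv' ?_
  have hcont : ContinuousOn (polyFun c ∘ Function.invFunOn K.map K.refClosed)
      (K.map '' K.refClosed) :=
    (contDiff_polyFun c (n := 0)).continuous.comp_continuousOn hf.continuousOn_inv
  have h3 := (hcont _ (mem_image_of_mem _ (hA hx))).mono (image_mono hsub)
  have h4 : (polyFun c' ∘ Function.invFunOn K.map K.refClosed) (K.map x) =
      (polyFun c ∘ Function.invFunOn K.map K.refClosed) (K.map x) := by
    simp only [Function.comp_apply, hf.inv_map (hA hx), hc x hx]
  rw [h4]
  exact h3

theorem contDiffOn_closure (hf : IsScaledMap K.refClosed k Λ h K.map) {A F : Set (E d)}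
    (hA : A ⊆ K.refClosed) (hFA : F ⊆ K.map '' A) (c : (Fin d → Fin (p + 1)) → ℝ) :
    ContDiffOn ℝ k (polyFun c ∘ Function.invFunOn K.map K.refClosed) (closure F) := by
  have hclosed : IsClosed (K.map '' K.refClosed) :=
    (K.isCompact_refClosed.image_of_continuousOn hf.continuousOn).isClosed
  exact ((contDiff_polyFun c).comp_contDiffOn
    (hf.contDiffOn_inv K.uniqueDiffOn_refClosed)).mono
      (closure_minimal (hFA.trans (image_mono hA)) hclosed)

end IsScaledMap

instance : Finite RefShape :=
  Finite.of_surjective (fun b : Bool => if b then RefShape.simplex else RefShape.cube) fun s => by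
    cases s
    · exact ⟨true, rfl⟩
    · exact ⟨false, rfl⟩

/-- The estimate on one reference facet holds with the same constant for all facets of both
reference elements, as these are finite in number. -/
theorem exists_sobolevNorm_le {d : ℕ} (hd : 1 ≤ d) (k p : ℕ) (Λ : RefShape → ℝ) (D : ℝ) {δ : ℝ}
    (hδ : 0 < δ) :
    ∃ C : ℝ, 0 < C ∧ ∀ (s : RefShape), ∀ A ∈ s.facets d, ∀ x ∈ A,
      ∀ c : (Fin d → Fin (p + 1)) → ℝ,
        ∃ c' : (Fin d → Fin (p + 1)) → ℝ, (∀ y ∈ A, polyFun c' y = polyFun c y) ∧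
          ∀ (h : ℝ) (f : E d → E d), IsScaledMap (s.closed d) k (Λ s) h f → h ≤ D →
            ∀ F ⊆ f '' A, (∀ y ∈ F, F ∈ 𝓝[f '' A] y) → f '' (A ∩ Metric.ball x δ) ⊆ F →
              ∀ η, 0 < η → η ≤ h → ∀ m ≤ k,
                sobolevNorm F m (polyFun c' ∘ Function.invFunOn f (s.closed d)) ≤
                  ENNReal.ofReal (C * η⁻¹ ^ m) *
                    eLpNorm (polyFun c' ∘ Function.invFunOn f (s.closed d)) 2
                      (surfaceMeasure F) := by
  have hfin : ∀ s : RefShape, Finite (s.facets d) := fun s => s.finite_facets.to_subtype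
  have hex : ∀ q : Σ s : RefShape, s.facets d, ∃ ℓ a, IsFlatFacet (q.1.closed d) q.2.1 ℓ a :=
    fun q => q.1.exists_isFlatFacet hd q.2.2
  choose ℓ a hA using hex
  choose C hC using fun q : Σ s : RefShape, s.facets d =>
    (hA q).exists_sobolevNorm_le q.1.uniqueDiffOn_closed q.1.isCompact_closed q.1.convex_closed
      k p (Λ q.1) D hδ
  obtain ⟨C₀, hC₀⟩ := (Set.finite_range C).bddAbove
  refine ⟨max C₀ 1, zero_lt_one.trans_le (le_max_right _ _), fun s A hAs x hx c => ?_⟩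
  obtain ⟨c', hc', H⟩ := hC ⟨s, A, hAs⟩ x hx c
  refine ⟨c', hc', fun h f hf hhD F hFA hF hxF η hη hηh m hm => ?_⟩
  refine (H h f hf hhD F hFA hF hxF η hη hηh m hm).trans ?_
  gcongr
  exact (hC₀ ⟨_, rfl⟩).trans (le_max_left _ _)

end CurvedDG

end

open CurvedDG

theorem mainTheorem7 (d : ℕ) (hd : 1 ≤ d) (Ω : Set (CurvedDG.E d)) (hΩ : IsOpen Ω)
    {I : Type*} (T : I → CurvedDG.Mesh d Ω) (k : ℕ)
    (hshape : CurvedDG.IsShapeRegular T) (hmaps : CurvedDG.HasRegularMaps k T)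
    (κ : CurvedDG.RefShape → CurvedDG.DegreeKind) (p : ℕ) (δ : ℝ) (hδ : 0 < δ) :
    ∃ C : ℝ, 0 < C ∧
      ∀ (i : I) (K : (T i).Elem) (F : Set (CurvedDG.E d)), (T i).IsFaceOf K F →
        ∀ v ∈ (T i).dgSpace κ p,
          ∃ g : CurvedDG.E d → ℝ,
            CurvedDG.IsTrace ((T i).elem K).carrier F v g ∧
            ContDiffOn ℝ k g (closure F) ∧
            (∀ m ≤ k, CurvedDG.sobolevNorm F m g < ⊤) ∧
            ((T i).IsCommensurate δ K F → ∀ m ≤ k,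
              CurvedDG.sobolevNorm F m g ≤
                ENNReal.ofReal (C * ((T i).faceSize F)⁻¹ ^ m) *
                  eLpNorm g 2 (CurvedDG.surfaceMeasure F)) := by

  obtain ⟨⟨σ, hσ, hball⟩, c₀, hc₀, hdist⟩ := hshape
  obtain ⟨hck, hM⟩ := hmaps
  choose! M hM using hM
  have hc₀top : c₀ ≠ ⊤ := (hc₀.trans ENNReal.one_lt_top).ne
  set c := c₀.toReal with hc
  have hc0 : 0 ≤ c := ENNReal.toReal_nonneg
  have hc1 : c < 1 := by
    rw [hc, ← ENNReal.toReal_one]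
    exact (ENNReal.toReal_lt_toReal hc₀top ENNReal.one_ne_top).2 hc₀
  have hcdist : ∀ i (K : (T i).Elem), ((T i).elem K).distortion ≤ ENNReal.ofReal c := fun i K => by
    rw [hc, ENNReal.ofReal_toReal hc₀top]
    exact hdist i K
  set D := Metric.diam (closure Ω) / (1 - c)
  have hsize : ∀ i (K : (T i).Elem), ((T i).elem K).size ≤ D := fun i K =>
    CurvedElement.size_le hc0 hc1 (hcdist i K) (T i).isBounded_closure ((T i).carrier_subset K)
  choose Λ hΛ using CurvedElement.exists_isScaledMap hd hσ hc0 hc1 k D M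
  have hscaled : ∀ i (K : (T i).Elem), IsScaledMap ((T i).elem K).refClosed k
      (Λ ((T i).elem K).shape) ((T i).elem K).size ((T i).elem K).map := fun i K =>
    hΛ _ ((T i).elem K) rfl (hball i K) (hcdist i K) (hsize i K) (hck i K)
      fun l h2l hlk => hM l h2l hlk i K
  obtain ⟨C, hC0, hC⟩ := exists_sobolevNorm_le hd k p Λ D hδ
  refine ⟨C, hC0, fun i K F hF v hv => ?_⟩
  have hf := hscaled i K
  obtain ⟨A, hA, hFA, hFrel⟩ := hF.exists_facet
  obtain ⟨ℓ, a, hflat⟩ := ((T i).elem K).shape.exists_isFlatFacet hd hA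
  obtain ⟨ρ, hρ, hvρ⟩ := hv.2 K
  obtain ⟨b, hb⟩ := exists_eval_eq_polyFun hρ
  have hvb : v =ᵐ[volume.restrict ((T i).elem K).carrier]
      fun x => polyFun b (((T i).elem K).invMap x) := by
    filter_upwards [hvρ] with x hx
    rw [hx, hb]
  -- change the coefficients outside the hyperplane of the facet, if an estimate is required
  obtain ⟨b', hb', hest⟩ : ∃ b' : (Fin d → Fin (p + 1)) → ℝ,
      (∀ y ∈ A, polyFun b' y = polyFun b y) ∧ ((T i).IsCommensurate δ K F → ∀ m ≤ k,
        sobolevNorm F m (polyFun b' ∘ Function.invFunOn ((T i).elem K).map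
            ((T i).elem K).refClosed) ≤
          ENNReal.ofReal (C * ((T i).faceSize F)⁻¹ ^ m) *
            eLpNorm (polyFun b' ∘ Function.invFunOn ((T i).elem K).map
              ((T i).elem K).refClosed) 2 (surfaceMeasure F)) := by
    by_cases hcomm : (T i).IsCommensurate δ K F
    · obtain ⟨A', hA', x, hx, hxF⟩ := hcomm
      have hAA' : A = A' := by
        obtain ⟨y, hy, hyx⟩ := hFA (hxF (mem_image_of_mem _ ⟨hx, Metric.mem_ball_self hδ⟩))
        obtain ⟨ℓ', a', hflat'⟩ := ((T i).elem K).shape.exists_isFlatFacet hd hA'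
        have hyx' := hf.injOn (hflat.subset hy) (hflat'.subset hx) hyx
        exact ((T i).elem K).shape.facets_eq_of_mem hA hA' hy (hyx' ▸ hx)
      subst hAA'
      obtain ⟨b', hb', hest⟩ := hC _ A hA x hx b
      exact ⟨b', hb', fun _ => hest _ _ hf (hsize i K) F hFA hFrel hxF _
        ((T i).faceSize_pos hd hF) ((T i).faceSize_le hF)⟩
    · exact ⟨b, fun _ _ => rfl, fun h => absurd h hcomm⟩
  exact ⟨polyFun b' ∘ Function.invFunOn ((T i).elem K).map ((T i).elem K).refClosed,
    hf.isTrace hflat.subset hflat.measurableSet hFA hvb hb',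
    hf.contDiffOn_closure hflat.subset hFA b',
    fun m hm => hflat.sobolevNorm_lt_top ((T i).elem K).uniqueDiffOn_refClosed
      ((T i).elem K).isCompact_refClosed hf hFA hFrel b' hm, hest⟩
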